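/- Let $\rho>0$, $\beta\ge 0$, $a>0$ and $x_0>0$ be fixed. For each $n\ge 1$ let $\tau_n>0$ and $\sigma_n,\gamma_n\in\mathbb{R}$ be such that $\beta=\tfrac12\sigma_n^2\tau_n n^2$ and $a=\gamma_n\tau_n n$. Let $Z^{(n)}$ be the Ornstein-Uhlenbeck process $dZ_t=-\gamma_n Z_t\,dt+\sigma_n\,dW_t$ started at $Z_0=0$ (with $W$ a standard Brownian motion). Sample it on the grid $t_i=i\tau_n$, and write $Z_i=Z^{(n)}_{t_i}$. Let $x^{(n)}_0=x_0$ and $$x^{(n)}_{i+1}=\bigl(1+\rho\, e^{Z_i-\frac12\mathrm{Var}(Z_i)}\bigr)\,x^{(n)}_i ,\qquad i\ge 0 .$$ Then $x^{(n)}_n$ is integrable for every $n\ge1$, the limit $$\lambda(\rho,\beta,a)=\lim_{n\to\infty}\frac1n\log\mathbb{E}\bigl[x^{(n)}_n\bigr]$$ exists and is finite, and $$\lambda(\rho,\beta,a)=\sup_{g\in\mathcal G}\Lambda[g],\qquad \Lambda[g]=(\log\rho)\, g(1)+\beta\int_0^1\!\!\int_0^1 g'(y)g'(z)K_2(y,z)\,dy\,dz-\int_0^1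 I(g'(x))\,dx ,$$ where $$K_2(y,z)=\frac1{2a}\bigl(e^{-a|y-z|}-e^{-a(y+z)}\bigr),\qquad I(x)=x\log x+(1-x)\log(1-x)\quad(0\log 0=0),$$ and $\mathcal G$ is the set of absolutely continuous functions $g:[0,1]\to[0,1]$ with $g(0)=0$ and $0\le g'(x)\le 1$ for almost every $x\in[0,1]$. -/

import Mathlib

open MeasureTheory ProbabilityTheory Filter Topology
open scoped NNReal

namespace OUGrowth

noncomputable section

/-- `Z` is a (continuous) solution on `[0, ∞)` of the Ornstein-Uhlenbeck equation
`dZ_t = - γ Z_t dt + σ dW_t` driven by the standard Brownian motion `W`. The noise is additive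
with the constant coefficient `σ`, so that the stochastic integral `∫_0^t σ dW_s` is `σ W_t`
(as `W_0 = 0` almost surely), and the integrated equation reads, almost surely for all `t`,
`Z_t = Z_0 - γ ∫_0^t Z_s ds + σ W_t`. -/
structure IsOrnsteinUhlenbeck {Ω : Type*} [MeasurableSpace Ω] (P : Measure Ω) (γ σ : ℝ)
    (W Z : ℝ≥0 → Ω → ℝ) : Prop where
  brownian : IsBrownianReal W P
  aemeasurable : ∀ t, AEMeasurable (Z t) P
  continuous_paths : ∀ᵐ ω ∂P, Continuous fun t => Z t ω
  equation : ∀ᵐ ω ∂P, ∀ t : ℝ≥0,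
    Z t ω = Z 0 ω - γ * (∫ s in (0 : ℝ)..(t : ℝ), Z s.toNNReal ω) + σ * W t ω

/-- The growth process `x_{i+1} = (1 + ρ exp (Y_i - Var(Y_i) / 2)) x_i` with deterministic initial
value `x_0 = x₀`, driven by the discrete-time process `Y`. -/
def growth {Ω : Type*} [MeasurableSpace Ω] (P : Measure Ω) (ρ x₀ : ℝ) (Y : ℕ → Ω → ℝ) :
    ℕ → Ω → ℝ
  | 0 => fun _ => x₀
  | i + 1 => fun ω => (1 + ρ * Real.exp (Y i ω - 1 / 2 * Var[Y i; P])) * growth P ρ x₀ Y i ω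

/-- The interaction kernel `K₂(y, z) = (e^{-a|y-z|} - e^{-a(y+z)}) / (2a)`. -/
def K₂ (a y z : ℝ) : ℝ :=
  1 / (2 * a) * (Real.exp (-a * |y - z|) - Real.exp (-a * (y + z)))

/-- The entropy function `I(x) = x log x + (1 - x) log (1 - x)`, with `0 log 0 = 0`. -/
def entropy (x : ℝ) : ℝ := x * Real.log x + (1 - x) * Real.log (1 - x)

/-- The class of absolutely continuous `g : [0,1] → [0,1]` with `g(0) = 0` and `0 ≤ g' ≤ 1`
almost everywhere. A function on `[0,1]` is represented by any of its extensions to `ℝ`; nothing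
below depends on the values outside `[0,1]`. -/
def admissible : Set (ℝ → ℝ) :=
  {g | Set.MapsTo g (Set.Icc 0 1) (Set.Icc 0 1) ∧ g 0 = 0 ∧
    AbsolutelyContinuousOnInterval g 0 1 ∧
    ∀ᵐ x ∂(volume.restrict (Set.Icc (0 : ℝ) 1)), 0 ≤ deriv g x ∧ deriv g x ≤ 1}

/-- The functional
`Λ[g] = log ρ · g(1) + β ∫₀¹∫₀¹ g'(y) g'(z) K₂(y, z) dy dz - ∫₀¹ I(g'(x)) dx`. -/
def Λ (ρ β a : ℝ) (g : ℝ → ℝ) : ℝ :=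
  Real.log ρ * g 1
    + β * (∫ y in (0 : ℝ)..1, ∫ z in (0 : ℝ)..1, deriv g y * deriv g z * K₂ a y z)
    - ∫ x in (0 : ℝ)..1, entropy (deriv g x)

end

end OUGrowth

namespace OUGrowth

/-! The recursion makes `x_n` a product over sites `i < n`, which expands into a sum over subsets
`S`. The Gaussian moment generating function turns the expectation into the partition function of a
lattice gas: `S` has weight `ρ^|S|` times the exponential of half the sum of `Cov(Z_i, Z_j)` over
ordered pairs `i ≠ j` in `S`, the diagonal being cancelled by the compensator `Var / 2`. Under the
prescribed scaling this half covariance is exactly `(β / n) K₂(i/n, j/n)`: a long-range interaction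
of strength `1/n`, for which mean-field theory is exact.

As a covariance, the interaction is positive semidefinite, so the energy is convex and lies above
its tangents. A linearised energy has a partition function that factorises over sites, and `log (1 +
e^t)` is the maximum of `t p + binEntropy p`. Linearising at any profile `p` therefore bounds the
partition function below by the exponential of the mean-field free energy (`exp_freeEnergy_le_sum`).
For the upper bound, configurations are grouped by their interaction field. Inside a group the
energy is nearly linear, so the group contributes at most the exponential of the maximal free
energy, up to a small cost per site (`sum_exp_le_of_field`). The field is bounded and Lipschitz
uniformly in `n`, so for a given precision the number of groups does not grow with `n`, and its
logarithm divided by `n` vanishes.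

The free energy per site is compared with the continuum functional through cell averages and step
functions: Jensen's inequality handles the entropy, and the Lipschitz kernel gives `O(1/n)` errors
(`IsDensity.densityFunctional_le`, `freeEnergy_le_densityFunctional`).

The joint law of the `Z_i` is found pathwise. Variation of constants expresses `Z` through `W`, and
this expression is an almost sure limit of weighted sums of independent Brownian increments
(`IsOrnsteinUhlenbeck.hasLaw_sum`). -/

/-- The bilinear form `∑ i j, p i * q j * A i j` over a finite index set. -/
noncomputable def bilin {ι : Type*} (s : Finset ι) (A : ι → ι → ℝ) (p q : ι → ℝ) : ℝ :=
  ∑ i ∈ s, ∑ j ∈ s, p i * q j * A i j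

/-- The mean-field free energy of the product Bernoulli measure with parameters `p`. -/
noncomputable def freeEnergy {ι : Type*} (s : Finset ι) (A : ι → ι → ℝ) (l : ℝ) (p : ι → ℝ) : ℝ :=
  ∑ i ∈ s, (l * p i + Real.binEntropy (p i)) + bilin s A p p

/-- The indicator of a finite set, with real values. -/
noncomputable def indic {ι : Type*} [DecidableEq ι] (S : Finset ι) (i : ι) : ℝ :=
  if i ∈ S then 1 else 0

/-! ### Mean-field bounds for partition functions with a positive semidefinite interaction. -/

section Gibbs

lemma negMulLog_le_of_pos {x q : ℝ} (hx : 0 ≤ x) (hq : 0 < q) :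
    Real.negMulLog x ≤ q - x - x * Real.log q := by
  rcases hx.eq_or_lt with rfl | hx
  · simp [Real.negMulLog, hq.le]
  · have h := Real.log_le_sub_one_of_pos (div_pos hq hx)
    rw [Real.log_div hq.ne' hx.ne'] at h
    have h2 := mul_le_mul_of_nonneg_left h hx.le
    have h3 : x * (q / x - 1) = q - x := by field_simp
    rw [h3] at h2
    simp only [Real.negMulLog]
    linarith

/-- The logistic function. -/
noncomputable def logistic (t : ℝ) : ℝ := Real.exp t / (1 + Real.exp t)

lemma logistic_pos (t : ℝ) : 0 < logistic t := by unfold logistic; positivity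

lemma one_sub_logistic (t : ℝ) : 1 - logistic t = 1 / (1 + Real.exp t) := by
  unfold logistic
  have : 1 + Real.exp t ≠ 0 := by positivity
  field_simp
  ring

lemma logistic_le_one (t : ℝ) : logistic t ≤ 1 := by
  have h := one_sub_logistic t
  have : 0 < 1 / (1 + Real.exp t) := by positivity
  linarith

lemma log_logistic (t : ℝ) : Real.log (logistic t) = t - Real.log (1 + Real.exp t) := by
  unfold logistic
  rw [Real.log_div (by positivity) (by positivity), Real.log_exp]

lemma log_one_sub_logistic (t : ℝ) :
    Real.log (1 - logistic t) = - Real.log (1 + Real.exp t) := by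
  rw [one_sub_logistic, one_div, Real.log_inv]

/-- Legendre duality between `log (1 + e^t)` and the binary entropy. It is relative entropy
nonnegativity against the Bernoulli law of parameter `logistic t`, where equality holds. -/
lemma mul_add_binEntropy_le {p : ℝ} (h0 : 0 ≤ p) (h1 : p ≤ 1) (t : ℝ) :
    t * p + Real.binEntropy p ≤ Real.log (1 + Real.exp t) := by
  rw [Real.binEntropy_eq_negMulLog_add_negMulLog_one_sub]
  have a := negMulLog_le_of_pos h0 (logistic_pos t)
  have b := negMulLog_le_of_pos (sub_nonneg.2 h1) (q := 1 - logistic t)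
    (by rw [one_sub_logistic]; positivity)
  rw [log_logistic] at a
  rw [log_one_sub_logistic] at b
  linarith

lemma mul_add_binEntropy_logistic (t : ℝ) :
    t * logistic t + Real.binEntropy (logistic t) = Real.log (1 + Real.exp t) := by
  rw [Real.binEntropy_eq_negMulLog_add_negMulLog_one_sub]
  simp only [Real.negMulLog]
  rw [log_logistic, log_one_sub_logistic]
  ring

variable {ι : Type*}

lemma bilin_comm (s : Finset ι) {A : ι → ι → ℝ} (hA : ∀ i j, A i j = A j i) (p q : ι → ℝ) :
    bilin s A p q = bilin s A q p := by
  unfold bilin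
  rw [Finset.sum_comm]
  refine Finset.sum_congr rfl fun i _ => Finset.sum_congr rfl fun j _ => ?_
  rw [hA j i]; ring

/-- Second-order expansion at `q`. For a positive semidefinite `A` the last term has a sign, and
this is the convexity used in both bounds. -/
lemma bilin_self_eq (s : Finset ι) {A : ι → ι → ℝ} (hA : ∀ i j, A i j = A j i) (p q : ι → ℝ) :
    bilin s A p p = bilin s A q q + 2 * bilin s A (p - q) q + bilin s A (p - q) (p - q) := by
  have h : bilin s A (p - q) (p - q)
      = bilin s A p p - bilin s A p q - (bilin s A q p - bilin s A q q) := by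
    simp only [bilin, ← Finset.sum_sub_distrib, Pi.sub_apply]
    refine Finset.sum_congr rfl fun i _ => Finset.sum_congr rfl fun j _ => ?_
    ring
  have h2 : bilin s A (p - q) q = bilin s A p q - bilin s A q q := by
    simp only [bilin, ← Finset.sum_sub_distrib, Pi.sub_apply]
    refine Finset.sum_congr rfl fun i _ => Finset.sum_congr rfl fun j _ => ?_
    ring
  rw [h, h2, bilin_comm s hA q p]
  ring

lemma bilin_eq_sum_mul (s : Finset ι) (A : ι → ι → ℝ) (p q : ι → ℝ) :
    bilin s A p q = ∑ i ∈ s, p i * ∑ j ∈ s, q j * A i j := by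
  simp only [bilin, Finset.mul_sum, mul_assoc]

lemma sum_powerset_exp_sum (s : Finset ι) (t : ι → ℝ) :
    ∑ S ∈ s.powerset, Real.exp (∑ i ∈ S, t i)
      = Real.exp (∑ i ∈ s, Real.log (1 + Real.exp (t i))) := by
  rw [Real.exp_sum]
  simp only [Real.exp_sum]
  rw [← Finset.prod_one_add]
  refine Finset.prod_congr rfl fun i _ => ?_
  rw [Real.exp_log (by positivity)]

variable [DecidableEq ι]

lemma sum_indic_mul {s S : Finset ι} (hS : S ⊆ s) (f : ι → ℝ) :
    ∑ i ∈ s, indic S i * f i = ∑ i ∈ S, f i := by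
  simp only [indic, ite_mul, one_mul, zero_mul]
  rw [← Finset.sum_filter, Finset.filter_mem_eq_inter, Finset.inter_eq_right.2 hS]

lemma bilin_indic {s S : Finset ι} (hS : S ⊆ s) (A : ι → ι → ℝ) :
    bilin s A (indic S) (indic S) = ∑ i ∈ S, ∑ j ∈ S, A i j := by
  rw [bilin_eq_sum_mul, sum_indic_mul hS]
  exact Finset.sum_congr rfl fun i _ => sum_indic_mul hS _

/-- The linearisation of the energy at `q`, in the direction of `S`. -/
lemma energy_linear {s S : Finset ι} (hS : S ⊆ s) (A : ι → ι → ℝ) (l : ℝ) (q : ι → ℝ) :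
    ∑ i ∈ S, (l + 2 * ∑ j ∈ s, q j * A i j)
      = l * S.card + 2 * bilin s A (indic S - q) q + 2 * bilin s A q q := by
  have h : bilin s A (indic S - q) q = bilin s A (indic S) q - bilin s A q q := by
    simp only [bilin, ← Finset.sum_sub_distrib, Pi.sub_apply]
    refine Finset.sum_congr rfl fun i _ => Finset.sum_congr rfl fun j _ => ?_
    ring
  rw [h, bilin_eq_sum_mul s A (indic S), sum_indic_mul hS, Finset.sum_add_distrib, ← Finset.mul_sum]
  simp
  ring

/-- Gibbs variational lower bound for the partition function. -/
lemma exp_freeEnergy_le_sum (s : Finset ι) {A : ι → ι → ℝ} (hA : ∀ i j, A i j = A j i)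
    (hpsd : ∀ v, 0 ≤ bilin s A v v) (l : ℝ) {p : ι → ℝ} (hp : ∀ i ∈ s, 0 ≤ p i ∧ p i ≤ 1) :
    Real.exp (freeEnergy s A l p)
      ≤ ∑ S ∈ s.powerset, Real.exp (l * S.card + ∑ i ∈ S, ∑ j ∈ S, A i j) := by
  -- The gradient of the energy at `p`; replacing the energy by its tangent there decouples the
  -- sites.
  set t : ι → ℝ := fun i => l + 2 * ∑ j ∈ s, p j * A i j with ht
  calc Real.exp (freeEnergy s A l p)
      ≤ Real.exp (- bilin s A p p + ∑ i ∈ s, Real.log (1 + Real.exp (t i))) := by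
        refine Real.exp_le_exp.2 ?_
        have h1 : ∑ i ∈ s, (t i * p i + Real.binEntropy (p i))
            ≤ ∑ i ∈ s, Real.log (1 + Real.exp (t i)) :=
          Finset.sum_le_sum fun i hi => mul_add_binEntropy_le (hp i hi).1 (hp i hi).2 _
        have h2 : ∑ i ∈ s, (t i * p i + Real.binEntropy (p i))
            = ∑ i ∈ s, (l * p i + Real.binEntropy (p i)) + 2 * bilin s A p p := by
          rw [bilin_eq_sum_mul, Finset.mul_sum, ← Finset.sum_add_distrib]
          refine Finset.sum_congr rfl fun i _ => ?_
          simp only [ht]; ring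
        unfold freeEnergy
        linarith
    _ = ∑ S ∈ s.powerset, Real.exp (- bilin s A p p + ∑ i ∈ S, t i) := by
        simp only [Real.exp_add, ← Finset.mul_sum, sum_powerset_exp_sum]
    _ ≤ _ := by
        -- The energy dominates its tangent at `p`: the quadratic remainder is nonnegative.
        refine Finset.sum_le_sum fun S hS => Real.exp_le_exp.2 ?_
        have hS := Finset.mem_powerset.1 hS
        rw [energy_linear hS, ← bilin_indic hS, bilin_self_eq s hA (indic S) p]
        linarith [hpsd (indic S - p)]

/-- A class of configurations with nearly constant interaction field contributes at most the
exponential of the maximal free energy, up to the fluctuation of the field. -/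
lemma sum_exp_le_of_field (s : Finset ι) {A : ι → ι → ℝ} (hA : ∀ i j, A i j = A j i)
    (hpsd : ∀ v, 0 ≤ bilin s A v v) (l : ℝ) {M ε : ℝ}
    (hM : ∀ p : ι → ℝ, (∀ i ∈ s, 0 ≤ p i ∧ p i ≤ 1) → freeEnergy s A l p ≤ M)
    (C : Finset (Finset ι)) (hC : C ⊆ s.powerset)
    (hε : ∀ S ∈ C, ∀ T ∈ C, ∀ i ∈ s, |∑ j ∈ S, A i j - ∑ j ∈ T, A i j| ≤ ε) :
    ∑ S ∈ C, Real.exp (l * S.card + ∑ i ∈ S, ∑ j ∈ S, A i j) ≤ Real.exp (M + ε * s.card) := by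
  rcases C.eq_empty_or_nonempty with rfl | ⟨T, hT⟩
  · simp [Real.exp_nonneg]
  have hTs := Finset.mem_powerset.1 (hC hT)
  set q : ι → ℝ := indic T
  set t : ι → ℝ := fun i => l + 2 * ∑ j ∈ s, q j * A i j with ht
  calc ∑ S ∈ C, Real.exp (l * S.card + ∑ i ∈ S, ∑ j ∈ S, A i j)
      ≤ ∑ S ∈ C, Real.exp (ε * s.card - bilin s A q q + ∑ i ∈ S, t i) := by
        refine Finset.sum_le_sum fun S hS => Real.exp_le_exp.2 ?_
        have hSs := Finset.mem_powerset.1 (hC hS)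
        rw [energy_linear hSs, ← bilin_indic hSs, bilin_self_eq s hA (indic S) q]
        -- The remainder pairs a vector with entries in `{-1, 0, 1}` with the difference of the two
        -- fields, which is at most `ε` at each site.
        have : bilin s A (indic S - q) (indic S - q) ≤ ε * s.card := by
          rw [bilin_eq_sum_mul, mul_comm, ← nsmul_eq_mul]
          refine Finset.sum_le_card_nsmul _ _ _ fun i hi => ?_
          have e : ∑ j ∈ s, (indic S - q) j * A i j = ∑ j ∈ S, A i j - ∑ j ∈ T, A i j := by
            simp only [Pi.sub_apply, sub_mul, Finset.sum_sub_distrib]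
            rw [sum_indic_mul hSs, sum_indic_mul hTs]
          rw [e]
          refine (le_abs_self _).trans ?_
          rw [abs_mul]
          have h1 : |(indic S - q) i| ≤ 1 := by
            simp only [Pi.sub_apply, q, indic]
            split_ifs <;> norm_num
          calc _ ≤ 1 * ε := mul_le_mul h1 (hε S hS T hT i hi) (abs_nonneg _) zero_le_one
            _ = ε := one_mul _
        linarith
    _ ≤ ∑ S ∈ s.powerset, Real.exp (ε * s.card - bilin s A q q + ∑ i ∈ S, t i) :=
        Finset.sum_le_sum_of_subset_of_nonneg hC fun _ _ _ => Real.exp_nonneg _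
    _ = Real.exp (ε * s.card - bilin s A q q + ∑ i ∈ s, Real.log (1 + Real.exp (t i))) := by
        simp only [Real.exp_add, ← Finset.mul_sum, sum_powerset_exp_sum]
    _ ≤ _ := by
        refine Real.exp_le_exp.2 ?_
        -- The maximiser of the linearised functional. Convexity, now read at `p`, bounds the
        -- linearised value by the true free energy of `p`.
        set p : ι → ℝ := fun i => logistic (t i)
        have h1 := hM p fun i _ => ⟨(logistic_pos _).le, logistic_le_one _⟩
        have h2 : ∑ i ∈ s, Real.log (1 + Real.exp (t i))
            = ∑ i ∈ s, (l * p i + Real.binEntropy (p i)) + 2 * bilin s A p q := by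
          rw [bilin_eq_sum_mul, Finset.mul_sum, ← Finset.sum_add_distrib]
          refine Finset.sum_congr rfl fun i _ => ?_
          rw [← mul_add_binEntropy_logistic]
          simp only [ht, p]; ring
        have h3 := hpsd (p - q)
        have h4 := bilin_self_eq s hA p q
        have h5 : bilin s A (p - q) q = bilin s A p q - bilin s A q q := by
          simp only [bilin, ← Finset.sum_sub_distrib, Pi.sub_apply]
          refine Finset.sum_congr rfl fun i _ => Finset.sum_congr rfl fun j _ => ?_
          ring
        unfold freeEnergy at h1
        linarith

/-- Mean-field upper bound for the partition function, by classifying the configurations. -/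
lemma sum_exp_le_card_mul (s : Finset ι) {A : ι → ι → ℝ} (hA : ∀ i j, A i j = A j i)
    (hpsd : ∀ v, 0 ≤ bilin s A v v) (l : ℝ) {M ε : ℝ}
    (hM : ∀ p : ι → ℝ, (∀ i ∈ s, 0 ≤ p i ∧ p i ≤ 1) → freeEnergy s A l p ≤ M)
    {κ : Type*} [Fintype κ] [DecidableEq κ] (c : Finset ι → κ)
    (hε : ∀ S ⊆ s, ∀ T ⊆ s, c S = c T → ∀ i ∈ s, |∑ j ∈ S, A i j - ∑ j ∈ T, A i j| ≤ ε) :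
    ∑ S ∈ s.powerset, Real.exp (l * S.card + ∑ i ∈ S, ∑ j ∈ S, A i j)
      ≤ Fintype.card κ * Real.exp (M + ε * s.card) := by
  rw [← Finset.sum_fiberwise (s := s.powerset) (g := c)]
  rw [← Finset.card_univ, ← nsmul_eq_mul]
  refine Finset.sum_le_card_nsmul _ _ _ fun k _ => ?_
  refine sum_exp_le_of_field s hA hpsd l hM _ (Finset.filter_subset _ _) ?_
  intro S hS T hT i hi
  simp only [Finset.mem_filter, Finset.mem_powerset] at hS hT
  exact hε S hS.1 T hT.1 (hS.2.trans hT.2.symm) i hi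

end Gibbs

/-! ### Bounds for the kernel, uniform in `n`. -/

section Kernel

lemma abs_exp_neg_sub_exp_neg_le {u v : ℝ} (hu : 0 ≤ u) (hv : 0 ≤ v) :
    |Real.exp (-u) - Real.exp (-v)| ≤ |u - v| := by
  wlog h : u ≤ v generalizing u v
  · rw [abs_sub_comm, abs_sub_comm u v]
    exact this hv hu (le_of_not_ge h)
  have h1 : Real.exp (-v) ≤ Real.exp (-u) := Real.exp_le_exp.2 (by linarith)
  rw [abs_of_nonneg (by linarith), abs_sub_comm, abs_of_nonneg (by linarith)]
  have h2 : Real.exp (-v) = Real.exp (-u) * Real.exp (u - v) := by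
    rw [← Real.exp_add]; ring_nf
  have h3 := Real.add_one_le_exp (u - v)
  have h4 : Real.exp (-u) ≤ 1 := Real.exp_le_one_iff.2 (by linarith)
  have h5 := Real.exp_pos (-u)
  rw [h2]
  nlinarith

lemma K₂_symm (a y z : ℝ) : K₂ a y z = K₂ a z y := by
  unfold K₂
  rw [abs_sub_comm, add_comm y z]

/-- Each exponential is `a`-Lipschitz in `y`, and the prefactor `1 / (2a)` brings the total constant
to exactly `1`. -/
lemma abs_K₂_sub_le {a : ℝ} (ha : 0 < a) {y y' z : ℝ} (hy : 0 ≤ y) (hy' : 0 ≤ y') (hz : 0 ≤ z) :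
    |K₂ a y z - K₂ a y' z| ≤ |y - y'| := by
  have h1 := abs_exp_neg_sub_exp_neg_le (u := a * |y - z|) (v := a * |y' - z|)
    (by positivity) (by positivity)
  have h2 := abs_exp_neg_sub_exp_neg_le (u := a * (y + z)) (v := a * (y' + z))
    (by positivity) (by positivity)
  have h3 : |(a * |y - z|) - (a * |y' - z|)| ≤ a * |y - y'| := by
    rw [← mul_sub, abs_mul, abs_of_pos ha]
    refine mul_le_mul_of_nonneg_left ?_ ha.le
    have := abs_abs_sub_abs_le_abs_sub (y - z) (y' - z)
    simpa using this
  have h4 : |a * (y + z) - a * (y' + z)| = a * |y - y'| := by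
    rw [← mul_sub, abs_mul, abs_of_pos ha]
    congr 2; ring
  have e : K₂ a y z - K₂ a y' z = 1 / (2 * a) *
      ((Real.exp (-(a * |y - z|)) - Real.exp (-(a * |y' - z|)))
        - (Real.exp (-(a * (y + z))) - Real.exp (-(a * (y' + z))))) := by
    unfold K₂
    simp only [neg_mul]
    ring
  rw [e, abs_mul, abs_of_pos (by positivity)]
  calc _ ≤ 1 / (2 * a) * (a * |y - y'| + a * |y - y'|) := by
        refine mul_le_mul_of_nonneg_left ?_ (by positivity)
        refine (abs_sub _ _).trans ?_
        linarith
    _ = |y - y'| := by field_simp; ring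

lemma K₂_nonneg {a : ℝ} (ha : 0 < a) {y z : ℝ} (hy : 0 ≤ y) (hz : 0 ≤ z) : 0 ≤ K₂ a y z := by
  unfold K₂
  refine mul_nonneg (by positivity) (sub_nonneg.2 (Real.exp_le_exp.2 ?_))
  have : |y - z| ≤ y + z := abs_le.2 ⟨by linarith, by linarith⟩
  nlinarith

lemma K₂_le {a : ℝ} (ha : 0 < a) (y z : ℝ) : K₂ a y z ≤ 1 / (2 * a) := by
  unfold K₂
  refine mul_le_of_le_one_right (by positivity) ?_
  have h1 : Real.exp (-a * |y - z|) ≤ 1 :=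
    Real.exp_le_one_iff.2 (by nlinarith [abs_nonneg (y - z)])
  have := Real.exp_pos (-a * (y + z))
  linarith

end Kernel

/-! ### Discretisation of the functional on the uniform grid. -/

section Density

/-- A measurable function with values in `[0, 1]` almost everywhere on `[0, 1]`. -/
structure IsDensity (f : ℝ → ℝ) : Prop where
  measurable : Measurable f
  mem : ∀ᵐ x, x ∈ Set.Icc (0 : ℝ) 1 → 0 ≤ f x ∧ f x ≤ 1

variable {f : ℝ → ℝ}

lemma IsDensity.intervalIntegrable_comp (hf : IsDensity f) {h : ℝ → ℝ} (hh : Measurable h) {C : ℝ}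
    (hC : ∀ x, 0 ≤ x → x ≤ 1 → ‖h x‖ ≤ C) : IntervalIntegrable (fun x => h (f x)) volume 0 1 := by
  rw [intervalIntegrable_iff_integrableOn_Icc_of_le zero_le_one]
  refine Measure.integrableOn_of_bounded (M := C) (by simp)
    (hh.comp hf.measurable).aestronglyMeasurable ?_
  rw [ae_restrict_iff' measurableSet_Icc]
  filter_upwards [hf.mem] with x hx hx1
  exact hC _ (hx hx1).1 (hx hx1).2

lemma IsDensity.intervalIntegrable (hf : IsDensity f) : IntervalIntegrable f volume 0 1 :=
  hf.intervalIntegrable_comp measurable_id (C := 1) fun x h0 h1 => by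
    simpa [abs_of_nonneg h0] using h1

lemma IsDensity.intervalIntegrable_binEntropy (hf : IsDensity f) :
    IntervalIntegrable (fun x => Real.binEntropy (f x)) volume 0 1 :=
  hf.intervalIntegrable_comp Real.binEntropy_continuous.measurable (C := Real.log 2)
    fun x h0 h1 => by
      rw [Real.norm_of_nonneg (Real.binEntropy_nonneg h0 h1)]
      exact Real.binEntropy_le_log_two

/-- The functional `Λ` in terms of the density `g'`. -/
noncomputable def densityFunctional (ρ β a : ℝ) (f : ℝ → ℝ) : ℝ :=
  Real.log ρ * (∫ x in (0 : ℝ)..1, f x)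
    + β * (∫ y in (0 : ℝ)..1, f y * ∫ z in (0 : ℝ)..1, f z * K₂ a y z)
    + ∫ x in (0 : ℝ)..1, Real.binEntropy (f x)

/-- The average of `f` over the `i`-th cell of the uniform grid of `[0, 1]` of size `n`. -/
noncomputable def cellAverage (n : ℕ) (f : ℝ → ℝ) (i : ℕ) : ℝ :=
  n * ∫ x in (i / n : ℝ)..((i + 1 : ℕ) / n : ℝ), f x

section Cells

variable {n i : ℕ}

lemma cell_le (n i : ℕ) : (i / n : ℝ) ≤ ((i + 1 : ℕ) / n : ℝ) := by
  push_cast; gcongr; linarith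

lemma cell_sub (i : ℕ) : ((i + 1 : ℕ) / n : ℝ) - i / n = 1 / n := by
  push_cast; ring

lemma cell_subset (hi : i < n) :
    Set.Icc (i / n : ℝ) ((i + 1 : ℕ) / n : ℝ) ⊆ Set.Icc 0 1 := by
  have hn : (0 : ℝ) < n := by exact_mod_cast (Nat.zero_le i).trans_lt hi
  refine Set.Icc_subset_Icc (by positivity) ?_
  rw [div_le_one hn]
  exact_mod_cast hi

lemma cell_mem (hi : i < n) : (i / n : ℝ) ∈ Set.Icc (0 : ℝ) 1 :=
  cell_subset hi ⟨le_rfl, cell_le n i⟩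

lemma intervalIntegrable_cell {F : ℝ → ℝ} (hF : IntervalIntegrable F volume 0 1) (hi : i < n) :
    IntervalIntegrable F volume (i / n : ℝ) ((i + 1 : ℕ) / n : ℝ) := by
  refine hF.mono_set ?_
  rw [Set.uIcc_of_le (cell_le n i), Set.uIcc_of_le zero_le_one]
  exact cell_subset hi

lemma integral_eq_sum_cells {F : ℝ → ℝ} (hF : IntervalIntegrable F volume 0 1) (hn : 0 < n) :
    ∫ x in (0 : ℝ)..1, F x
      = ∑ i ∈ Finset.range n, ∫ x in (i / n : ℝ)..((i + 1 : ℕ) / n : ℝ), F x := by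
  have hn' : (n : ℝ) ≠ 0 := by exact_mod_cast hn.ne'
  have := intervalIntegral.sum_integral_adjacent_intervals (μ := volume) (f := F)
    (a := fun k : ℕ => (k / n : ℝ)) (n := n) fun k hk => intervalIntegrable_cell hF hk
  rw [this]
  simp [hn']

lemma IsDensity.ae_cell (hf : IsDensity f) (hi : i < n) :
    ∀ᵐ x ∂(volume.restrict (Set.Ioc (i / n : ℝ) ((i + 1 : ℕ) / n : ℝ))), f x ∈ Set.Icc 0 1 := by
  rw [ae_restrict_iff' measurableSet_Ioc]
  filter_upwards [hf.mem] with x hx hx1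
  exact hx (cell_subset hi (Set.Ioc_subset_Icc_self hx1))

lemma cellAverage_eq_average (f : ℝ → ℝ) (hi : i < n) :
    cellAverage n f i = ⨍ x in Set.Ioc (i / n : ℝ) ((i + 1 : ℕ) / n : ℝ), f x := by
  have hn : (0 : ℝ) < n := by exact_mod_cast (Nat.zero_le i).trans_lt hi
  rw [setAverage_eq, cellAverage, intervalIntegral.integral_of_le (cell_le n i),
    Real.volume_real_Ioc_of_le (cell_le n i), cell_sub]
  simp

lemma IsDensity.cellAverage_mem (hf : IsDensity f) (hi : i < n) :
    0 ≤ cellAverage n f i ∧ cellAverage n f i ≤ 1 := by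
  have hn : (0 : ℝ) < n := by exact_mod_cast (Nat.zero_le i).trans_lt hi
  rw [cellAverage, intervalIntegral.integral_of_le (cell_le n i)]
  have h0 : 0 ≤ ∫ x in Set.Ioc (i / n : ℝ) ((i + 1 : ℕ) / n : ℝ), f x :=
    integral_nonneg_of_ae ((hf.ae_cell hi).mono fun x hx => hx.1)
  refine ⟨mul_nonneg hn.le h0, ?_⟩
  have h1 : ∫ x in Set.Ioc (i / n : ℝ) ((i + 1 : ℕ) / n : ℝ), f x
      ≤ ∫ x in Set.Ioc (i / n : ℝ) ((i + 1 : ℕ) / n : ℝ), (1 : ℝ) := by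
    refine integral_mono_ae ?_ (by simp) ((hf.ae_cell hi).mono fun x hx => hx.2)
    exact (intervalIntegrable_iff_integrableOn_Ioc_of_le (cell_le n i)).1
      (intervalIntegrable_cell hf.intervalIntegrable hi)
  rw [setIntegral_const, Real.volume_real_Ioc_of_le (cell_le n i), cell_sub] at h1
  calc _ ≤ (n : ℝ) * ((1 / n : ℝ) • (1 : ℝ)) := mul_le_mul_of_nonneg_left h1 hn.le
    _ = 1 := by simp [hn.ne']

lemma integral_cell_eq (f : ℝ → ℝ) (hn : 0 < n) (i : ℕ) :
    ∫ x in (i / n : ℝ)..((i + 1 : ℕ) / n : ℝ), f x = 1 / n * cellAverage n f i := by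
  have hn' : (n : ℝ) ≠ 0 := by exact_mod_cast hn.ne'
  rw [cellAverage]
  field_simp

/-- Jensen's inequality on each cell. -/
lemma IsDensity.integral_binEntropy_le (hf : IsDensity f) (hn : 0 < n) :
    ∫ x in (0 : ℝ)..1, Real.binEntropy (f x)
      ≤ 1 / n * ∑ i ∈ Finset.range n, Real.binEntropy (cellAverage n f i) := by
  have hn' : (0 : ℝ) < n := by exact_mod_cast hn
  rw [integral_eq_sum_cells hf.intervalIntegrable_binEntropy hn, Finset.mul_sum]
  refine Finset.sum_le_sum fun i hi => ?_
  have hi := Finset.mem_range.1 hi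
  rw [integral_cell_eq _ hn]
  refine mul_le_mul_of_nonneg_left ?_ (by positivity)
  rw [cellAverage_eq_average _ hi, cellAverage_eq_average _ hi]
  refine ConcaveOn.le_map_set_average (s := Set.Icc 0 1) Real.strictConcave_binEntropy.concaveOn
    Real.binEntropy_continuous.continuousOn isClosed_Icc ?_ (by simp) (hf.ae_cell hi) ?_ ?_
  · rw [Real.volume_Ioc, cell_sub]
    simpa using hn.ne'
  · exact (intervalIntegrable_iff_integrableOn_Ioc_of_le (cell_le n i)).1
      (intervalIntegrable_cell hf.intervalIntegrable hi)
  · exact (intervalIntegrable_iff_integrableOn_Ioc_of_le (cell_le n i)).1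
      (intervalIntegrable_cell hf.intervalIntegrable_binEntropy hi)

lemma IsDensity.intervalIntegrable_mul (hf : IsDensity f) {φ : ℝ → ℝ}
    (hφ : LipschitzOnWith 1 φ (Set.Icc 0 1)) :
    IntervalIntegrable (fun x => f x * φ x) volume 0 1 :=
  hf.intervalIntegrable.mul_continuousOn (by
    rw [Set.uIcc_of_le zero_le_one]; exact hφ.continuousOn)

/-- Freezing `φ` at the left end of a cell leaves exactly the cell average of `f`. The error is at
most `1/n²` on each of the `n` cells. -/
lemma IsDensity.integral_mul_sub_le (hf : IsDensity f) (hn : 0 < n) {φ : ℝ → ℝ}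
    (hφ : LipschitzOnWith 1 φ (Set.Icc 0 1)) :
    |(∫ x in (0 : ℝ)..1, f x * φ x)
      - 1 / n * ∑ i ∈ Finset.range n, cellAverage n f i * φ (i / n)| ≤ 1 / n := by
  have hn' : (0 : ℝ) < n := by exact_mod_cast hn
  rw [integral_eq_sum_cells (hf.intervalIntegrable_mul hφ) hn, Finset.mul_sum,
    ← Finset.sum_sub_distrib]
  have key : ∀ i ∈ Finset.range n, |(∫ x in (i / n : ℝ)..((i + 1 : ℕ) / n : ℝ), f x * φ x)
      - 1 / n * (cellAverage n f i * φ (i / n))| ≤ 1 / n * (1 / n) := by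
    intro i hi
    have hi := Finset.mem_range.1 hi
    rw [← mul_assoc, ← integral_cell_eq f hn, ← intervalIntegral.integral_mul_const,
      ← intervalIntegral.integral_sub (intervalIntegrable_cell (hf.intervalIntegrable_mul hφ) hi)
        ((intervalIntegrable_cell hf.intervalIntegrable hi).mul_const _)]
    have := intervalIntegral.norm_integral_le_of_norm_le_const_ae (a := (i / n : ℝ))
      (b := ((i + 1 : ℕ) / n : ℝ)) (f := fun x => f x * φ x - f x * φ (i / n)) (C := 1 / n) ?_
    · rwa [cell_sub, Real.norm_eq_abs, abs_of_pos (a := (1 / n : ℝ)) (by positivity)] at this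
    · rw [Set.uIoc_of_le (cell_le n i)]
      filter_upwards [hf.mem] with x hx hxi
      have hx1 := cell_subset hi (Set.Ioc_subset_Icc_self hxi)
      have hd := hφ.dist_le_mul x hx1 _ (cell_mem hi)
      rw [Real.dist_eq, Real.dist_eq, NNReal.coe_one, one_mul] at hd
      rw [← mul_sub, Real.norm_eq_abs, abs_mul, abs_of_nonneg (hx hx1).1]
      have h2 : |x - i / n| ≤ 1 / n := by
        rw [abs_of_nonneg (by linarith [hxi.1]), ← cell_sub i]
        linarith [hxi.2]
      calc f x * |φ x - φ (i / n)| ≤ 1 * (1 / n) :=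
            mul_le_mul (hx hx1).2 (hd.trans h2) (abs_nonneg _) zero_le_one
        _ = 1 / n := one_mul _
  refine (Finset.abs_sum_le_sum_abs _ _).trans ((Finset.sum_le_card_nsmul _ _ _ key).trans ?_)
  rw [Finset.card_range, nsmul_eq_mul]
  apply le_of_eq
  field_simp

end Cells

lemma lipschitzOnWith_K₂ {a : ℝ} (ha : 0 < a) {z : ℝ} (hz : 0 ≤ z) :
    LipschitzOnWith 1 (fun y => K₂ a y z) (Set.Icc 0 1) :=
  LipschitzOnWith.of_dist_le_mul fun y hy y' hy' => by
    rw [Real.dist_eq, Real.dist_eq, NNReal.coe_one, one_mul]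
    exact abs_K₂_sub_le ha hy.1 hy'.1 hz

lemma lipschitzOnWith_K₂' {a : ℝ} (ha : 0 < a) {y : ℝ} (hy : 0 ≤ y) :
    LipschitzOnWith 1 (fun z => K₂ a y z) (Set.Icc 0 1) := by
  simpa only [K₂_symm a y] using lipschitzOnWith_K₂ ha hy

lemma IsDensity.lipschitzOnWith_integral (hf : IsDensity f) {a : ℝ} (ha : 0 < a) :
    LipschitzOnWith 1 (fun y => ∫ z in (0 : ℝ)..1, f z * K₂ a y z) (Set.Icc 0 1) :=
  LipschitzOnWith.of_dist_le_mul fun y hy y' hy' => by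
    rw [Real.dist_eq, Real.dist_eq, NNReal.coe_one, one_mul,
      ← intervalIntegral.integral_sub (hf.intervalIntegrable_mul (lipschitzOnWith_K₂' ha hy.1))
        (hf.intervalIntegrable_mul (lipschitzOnWith_K₂' ha hy'.1))]
    have := intervalIntegral.norm_integral_le_of_norm_le_const_ae (a := (0 : ℝ)) (b := 1)
      (f := fun z => f z * K₂ a y z - f z * K₂ a y' z) (C := |y - y'|) ?_
    · simpa using this
    · rw [Set.uIoc_of_le zero_le_one]
      filter_upwards [hf.mem] with z hz hz1
      have hz2 := Set.Ioc_subset_Icc_self hz1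
      rw [← mul_sub, Real.norm_eq_abs, abs_mul, abs_of_nonneg (hz hz2).1]
      calc f z * |K₂ a y z - K₂ a y' z| ≤ 1 * |y - y'| :=
            mul_le_mul (hz hz2).2 (abs_K₂_sub_le ha hy.1 hy'.1 hz2.1) (abs_nonneg _) zero_le_one
        _ = _ := one_mul _

/-- The rescaled interaction matrix on the grid of size `n`. -/
noncomputable def gridKernel (β a : ℝ) (n : ℕ) (i j : ℕ) : ℝ := β / n * K₂ a (i / n) (j / n)

lemma gridKernel_symm (β a : ℝ) (n i j : ℕ) : gridKernel β a n i j = gridKernel β a n j i := by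
  unfold gridKernel
  rw [K₂_symm]

/-- The two variables are discretised one after the other, each at a cost `1/n` before the factor
`β`. -/
lemma IsDensity.abs_integral_sub_bilin_le (hf : IsDensity f) {a β : ℝ} (ha : 0 < a) (hβ : 0 ≤ β)
    {n : ℕ} (hn : 0 < n) :
    |β * (∫ y in (0 : ℝ)..1, f y * ∫ z in (0 : ℝ)..1, f z * K₂ a y z)
      - 1 / n * bilin (Finset.range n) (gridKernel β a n) (cellAverage n f) (cellAverage n f)|
      ≤ 2 * β / n := by
  have hn' : (0 : ℝ) < n := by exact_mod_cast hn
  set G : ℝ → ℝ := fun y => ∫ z in (0 : ℝ)..1, f z * K₂ a y z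
  set c := cellAverage n f
  have h1 := hf.integral_mul_sub_le hn (hf.lipschitzOnWith_integral ha)
  have e : 1 / n * bilin (Finset.range n) (gridKernel β a n) c c
      = β * (1 / n * ∑ i ∈ Finset.range n, c i *
        (1 / n * ∑ j ∈ Finset.range n, c j * K₂ a (i / n) (j / n))) := by
    simp only [bilin, gridKernel, Finset.mul_sum]
    refine Finset.sum_congr rfl fun i _ => Finset.sum_congr rfl fun j _ => ?_
    ring
  have h2 : |1 / n * ∑ i ∈ Finset.range n, c i * G (i / n) - 1 / n * ∑ i ∈ Finset.range n, c i *
        (1 / n * ∑ j ∈ Finset.range n, c j * K₂ a (i / n) (j / n))| ≤ 1 / n := by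
    rw [← mul_sub, ← Finset.sum_sub_distrib, abs_mul, abs_of_pos (by positivity)]
    refine mul_le_of_le_one_right (by positivity) ?_
    have : ∀ i ∈ Finset.range n, |c i * G (i / n)
        - c i * (1 / n * ∑ j ∈ Finset.range n, c j * K₂ a (i / n) (j / n))| ≤ 1 / n := by
      intro i hi
      have hi := Finset.mem_range.1 hi
      rw [← mul_sub, abs_mul, abs_of_nonneg (hf.cellAverage_mem hi).1]
      calc _ ≤ 1 * (1 / n : ℝ) := mul_le_mul (hf.cellAverage_mem hi).2
            (hf.integral_mul_sub_le hn (lipschitzOnWith_K₂' ha (cell_mem hi).1))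
            (abs_nonneg _) zero_le_one
        _ = _ := one_mul _
    refine (Finset.abs_sum_le_sum_abs _ _).trans ((Finset.sum_le_card_nsmul _ _ _ this).trans ?_)
    rw [Finset.card_range, nsmul_eq_mul]
    apply le_of_eq
    field_simp
  rw [e, ← mul_sub, abs_mul, abs_of_nonneg hβ]
  have h3 := (abs_sub_le _ _ _).trans (add_le_add h1 h2)
  calc _ ≤ β * (1 / n + 1 / n) := mul_le_mul_of_nonneg_left h3 hβ
    _ = _ := by ring

/-- Cell averaging preserves the linear term, so only two errors remain: the discretisation of the
kernel and the Jensen gap of the entropy. The gap is nonnegative in general and zero for step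
functions, which gives one inequality in each direction. -/
lemma freeEnergy_eq_densityFunctional_add (hf : IsDensity f) (ρ β a : ℝ) {n : ℕ} (hn : 0 < n) :
    1 / n * freeEnergy (Finset.range n) (gridKernel β a n) (Real.log ρ) (cellAverage n f)
      = densityFunctional ρ β a f
        - (β * (∫ y in (0 : ℝ)..1, f y * ∫ z in (0 : ℝ)..1, f z * K₂ a y z)
          - 1 / n * bilin (Finset.range n) (gridKernel β a n) (cellAverage n f) (cellAverage n f))
        + (1 / n * ∑ i ∈ Finset.range n, Real.binEntropy (cellAverage n f i)
          - ∫ x in (0 : ℝ)..1, Real.binEntropy (f x)) := by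
  have h : ∫ x in (0 : ℝ)..1, f x = 1 / n * ∑ i ∈ Finset.range n, cellAverage n f i := by
    rw [integral_eq_sum_cells hf.intervalIntegrable hn, Finset.mul_sum]
    exact Finset.sum_congr rfl fun i _ => integral_cell_eq f hn i
  unfold densityFunctional freeEnergy
  rw [h, Finset.sum_add_distrib, ← Finset.mul_sum]
  ring

lemma IsDensity.densityFunctional_le (hf : IsDensity f) (ρ : ℝ) {a β : ℝ} (ha : 0 < a)
    (hβ : 0 ≤ β) {n : ℕ} (hn : 0 < n) :
    densityFunctional ρ β a f
      ≤ 1 / n * freeEnergy (Finset.range n) (gridKernel β a n) (Real.log ρ) (cellAverage n f)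
        + 2 * β / n := by
  have h1 := freeEnergy_eq_densityFunctional_add hf ρ β a hn
  have h2 := hf.integral_binEntropy_le hn
  have h3 := abs_le.1 (hf.abs_integral_sub_bilin_le ha hβ hn)
  linarith [h3.2]

/-- The step function with value `p i` on the `i`-th cell. -/
noncomputable def stepFunction (n : ℕ) (p : ℕ → ℝ) (x : ℝ) : ℝ :=
  if ⌊n * x⌋₊ < n then p ⌊n * x⌋₊ else 0

variable {n : ℕ} {p : ℕ → ℝ}

lemma isDensity_stepFunction (hp : ∀ i ∈ Finset.range n, 0 ≤ p i ∧ p i ≤ 1) :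
    IsDensity (stepFunction n p) where
  measurable := (measurable_from_nat (f := fun k => if k < n then p k else 0)).comp
    (Nat.measurable_floor.comp (measurable_const_mul (n : ℝ)))
  mem := .of_forall fun x _ => by
    unfold stepFunction
    split_ifs with h
    · exact hp _ (Finset.mem_range.2 h)
    · norm_num

lemma stepFunction_eq {i : ℕ} (hi : i < n) {x : ℝ}
    (hx : x ∈ Set.Ioo (i / n : ℝ) ((i + 1 : ℕ) / n : ℝ)) : stepFunction n p x = p i := by
  have hn : (0 : ℝ) < n := by exact_mod_cast (Nat.zero_le i).trans_lt hi
  have h : ⌊n * x⌋₊ = i := by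
    have h1 := (div_lt_iff₀ hn).1 hx.1
    have h2 := (lt_div_iff₀ hn).1 hx.2
    rw [Nat.floor_eq_iff (by nlinarith [(Nat.cast_nonneg i : (0 : ℝ) ≤ i)])]
    push_cast at h2
    constructor <;> linarith
  simp [stepFunction, h, hi]

lemma integral_cell_stepFunction (h : ℝ → ℝ) {i : ℕ} (hi : i < n) :
    ∫ x in (i / n : ℝ)..((i + 1 : ℕ) / n : ℝ), h (stepFunction n p x) = 1 / n * h (p i) := by
  rw [intervalIntegral.integral_congr_Ioo_of_le (g := fun _ => h (p i)) (cell_le n i)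
    fun x hx => by simp only [stepFunction_eq hi hx]]
  rw [intervalIntegral.integral_const, cell_sub, smul_eq_mul]

lemma cellAverage_stepFunction {i : ℕ} (hi : i < n) : cellAverage n (stepFunction n p) i = p i := by
  have hn : (n : ℝ) ≠ 0 := by exact_mod_cast ((Nat.zero_le i).trans_lt hi).ne'
  rw [cellAverage, integral_cell_stepFunction (fun x => x) hi]
  field_simp

lemma freeEnergy_le_densityFunctional (ρ : ℝ) {a β : ℝ} (ha : 0 < a) (hβ : 0 ≤ β) (hn : 0 < n)
    (hp : ∀ i ∈ Finset.range n, 0 ≤ p i ∧ p i ≤ 1) :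
    1 / n * freeEnergy (Finset.range n) (gridKernel β a n) (Real.log ρ) p
      ≤ densityFunctional ρ β a (stepFunction n p) + 2 * β / n := by
  have hf := isDensity_stepFunction hp
  have h1 := freeEnergy_eq_densityFunctional_add hf ρ β a hn
  have h3 := abs_le.1 (hf.abs_integral_sub_bilin_le ha hβ hn)
  have h2 : ∫ x in (0 : ℝ)..1, Real.binEntropy (stepFunction n p x)
      = 1 / n * ∑ i ∈ Finset.range n, Real.binEntropy (cellAverage n (stepFunction n p) i) := by
    rw [integral_eq_sum_cells hf.intervalIntegrable_binEntropy hn, Finset.mul_sum]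
    refine Finset.sum_congr rfl fun i hi => ?_
    rw [integral_cell_stepFunction _ (Finset.mem_range.1 hi),
      cellAverage_stepFunction (Finset.mem_range.1 hi)]
  have e : freeEnergy (Finset.range n) (gridKernel β a n) (Real.log ρ) p
      = freeEnergy (Finset.range n) (gridKernel β a n) (Real.log ρ)
        (cellAverage n (stepFunction n p)) := by
    unfold freeEnergy bilin
    congr 1
    · refine Finset.sum_congr rfl fun i hi => ?_
      rw [cellAverage_stepFunction (Finset.mem_range.1 hi)]
    · refine Finset.sum_congr rfl fun i hi => Finset.sum_congr rfl fun j hj => ?_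
      rw [cellAverage_stepFunction (Finset.mem_range.1 hi),
        cellAverage_stepFunction (Finset.mem_range.1 hj)]
  rw [e]
  linarith [h3.1]

end Density

/-! ### Passage between admissible functions and their derivatives. -/

section Admissible

lemma entropy_eq (x : ℝ) : entropy x = - Real.binEntropy x := by
  simp only [entropy, Real.binEntropy, Real.log_inv]
  ring

lemma densityFunctional_congr (ρ β a : ℝ) {f g : ℝ → ℝ}
    (h : ∀ᵐ x, x ∈ Set.Icc (0 : ℝ) 1 → f x = g x) :
    densityFunctional ρ β a f = densityFunctional ρ β a g := by
  have h' : ∀ᵐ x, x ∈ Set.uIoc (0 : ℝ) 1 → f x = g x := by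
    rw [Set.uIoc_of_le zero_le_one]
    exact h.mono fun x hx hx1 => hx (Set.Ioc_subset_Icc_self hx1)
  unfold densityFunctional
  congr 1
  · congr 2
    · exact intervalIntegral.integral_congr_ae h'
    · refine intervalIntegral.integral_congr_ae (h'.mono fun y hy hy1 => ?_)
      rw [hy hy1]
      congr 1
      exact intervalIntegral.integral_congr_ae (h'.mono fun z hz hz1 => by rw [hz hz1])
  · exact intervalIntegral.integral_congr_ae (h'.mono fun z hz hz1 => by rw [hz hz1])

lemma isDensity_deriv {g : ℝ → ℝ} (hg : g ∈ admissible) : IsDensity (deriv g) where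
  measurable := measurable_deriv g
  mem := by
    have := hg.2.2.2
    rwa [ae_restrict_iff' measurableSet_Icc] at this

lemma Λ_eq_densityFunctional (ρ β a : ℝ) {g : ℝ → ℝ} (hg : g ∈ admissible) :
    Λ ρ β a g = densityFunctional ρ β a (deriv g) := by
  unfold Λ densityFunctional
  rw [hg.2.2.1.integral_deriv_eq_sub, hg.2.1, sub_zero]
  simp only [entropy_eq, intervalIntegral.integral_neg, sub_neg_eq_add, mul_assoc,
    intervalIntegral.integral_const_mul]

/-- The primitive of `f` works, since by Lebesgue differentiation its derivative is `f` almost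
everywhere. Hence the suprema over densities and over admissible functions coincide. -/
lemma exists_admissible {f : ℝ → ℝ} (hf : IsDensity f) (ρ β a : ℝ) :
    ∃ g ∈ admissible, Λ ρ β a g = densityFunctional ρ β a f := by
  set g : ℝ → ℝ := fun x => ∫ t in (0 : ℝ)..x, f t with hgdef
  have hae : ∀ᵐ x, x ∈ Set.Icc (0 : ℝ) 1 → deriv g x = f x := by
    have := hf.intervalIntegrable.ae_hasDerivAt_integral
    rw [Set.uIcc_of_le zero_le_one] at this
    filter_upwards [this] with x hx hx1
    exact (hx hx1 0 (by simp)).deriv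
  have hint : ∀ x ∈ Set.Icc (0 : ℝ) 1, IntegrableOn f (Set.Ioc 0 x) := fun x hx =>
    ((intervalIntegrable_iff_integrableOn_Ioc_of_le zero_le_one).1
      hf.intervalIntegrable).mono_set (Set.Ioc_subset_Ioc_right hx.2)
  have hmem : ∀ x ∈ Set.Icc (0 : ℝ) 1, ∀ᵐ t ∂(volume.restrict (Set.Ioc 0 x)),
      0 ≤ f t ∧ f t ≤ 1 := fun x hx => by
    rw [ae_restrict_iff' measurableSet_Ioc]
    filter_upwards [hf.mem] with t ht ht1
    exact ht ⟨ht1.1.le, ht1.2.trans hx.2⟩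
  have hg : g ∈ admissible := by
    refine ⟨fun x hx => ?_, by simp [hgdef], ?_, ?_⟩
    · simp only [hgdef]
      rw [intervalIntegral.integral_of_le hx.1]
      refine ⟨integral_nonneg_of_ae ((hmem x hx).mono fun t ht => ht.1), ?_⟩
      calc _ ≤ ∫ t in Set.Ioc 0 x, (1 : ℝ) :=
            integral_mono_ae (hint x hx) (by simp) ((hmem x hx).mono fun t ht => ht.2)
        _ ≤ 1 := by
            rw [setIntegral_const, Real.volume_real_Ioc_of_le hx.1]
            simpa using hx.2
    · exact hf.intervalIntegrable.absolutelyContinuousOnInterval_intervalIntegral (by simp)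
    · rw [ae_restrict_iff' measurableSet_Icc]
      filter_upwards [hf.mem, hae] with x hx h2 hx1
      rw [h2 hx1]
      exact hx hx1
  exact ⟨g, hg, by rw [Λ_eq_densityFunctional ρ β a hg, densityFunctional_congr ρ β a hae]⟩

lemma zero_mem_admissible : (fun _ => 0 : ℝ → ℝ) ∈ admissible := by
  refine ⟨fun x _ => by simp, rfl, ?_, by simp⟩
  exact ((LipschitzWith.const (0 : ℝ)).lipschitzOnWith).absolutelyContinuousOnInterval

end Admissible

/-! ### Asymptotics of the lattice gas partition function. -/

section Partition

/-- The partition function of the lattice gas with interaction `gridKernel`, without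
self-interaction. -/
noncomputable def partitionFunction (ρ β a : ℝ) (n : ℕ) : ℝ :=
  ∑ S ∈ (Finset.range n).powerset, Real.exp (Real.log ρ * S.card
    + ∑ i ∈ S, ∑ j ∈ S, gridKernel β a n i j - ∑ i ∈ S, gridKernel β a n i i)

variable {ρ β a : ℝ}

lemma partitionFunction_pos (ρ β a : ℝ) (n : ℕ) : 0 < partitionFunction ρ β a n :=
  Finset.sum_pos (fun _ _ => Real.exp_pos _) ⟨∅, by simp⟩

lemma gridKernel_nonneg (hβ : 0 ≤ β) (ha : 0 < a) (n i j : ℕ) : 0 ≤ gridKernel β a n i j :=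
  mul_nonneg (by positivity) (K₂_nonneg ha (by positivity) (by positivity))

lemma sum_gridKernel_diag_le (hβ : 0 ≤ β) (ha : 0 < a) {n : ℕ} (hn : 0 < n) {S : Finset ℕ}
    (hS : S ⊆ Finset.range n) : ∑ i ∈ S, gridKernel β a n i i ≤ β / (2 * a) := by
  have hn' : (0 : ℝ) < n := by exact_mod_cast hn
  calc ∑ i ∈ S, gridKernel β a n i i ≤ ∑ i ∈ Finset.range n, gridKernel β a n i i :=
        Finset.sum_le_sum_of_subset_of_nonneg hS fun i _ _ => gridKernel_nonneg hβ ha n i i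
    _ ≤ (Finset.range n).card • (β / n * (1 / (2 * a))) :=
        Finset.sum_le_card_nsmul _ _ _ fun i _ =>
          mul_le_mul_of_nonneg_left (K₂_le ha _ _) (by positivity)
    _ = β / (2 * a) := by
        rw [Finset.card_range, nsmul_eq_mul]
        field_simp

lemma densityFunctional_le_log_partitionFunction (ρ : ℝ) (hβ : 0 ≤ β) (ha : 0 < a) {n : ℕ}
    (hn : 0 < n)
    (hpsd : ∀ v, 0 ≤ bilin (Finset.range n) (gridKernel β a n) v v) {f : ℝ → ℝ}
    (hf : IsDensity f) :
    densityFunctional ρ β a f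
      ≤ 1 / n * Real.log (partitionFunction ρ β a n) + (2 * β + β / (2 * a)) / n := by
  have hn' : (0 : ℝ) < n := by exact_mod_cast hn
  have h1 := hf.densityFunctional_le ρ ha hβ hn
  have h2 := exp_freeEnergy_le_sum (Finset.range n) (gridKernel_symm β a n) hpsd (Real.log ρ)
    (p := cellAverage n f) fun i hi => hf.cellAverage_mem (Finset.mem_range.1 hi)
  -- Removing the self-interaction costs only a bounded factor, since the diagonal sums to at most
  -- `β / (2a)`.
  have h3 : Real.exp (-(β / (2 * a))) * ∑ S ∈ (Finset.range n).powerset,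
      Real.exp (Real.log ρ * S.card + ∑ i ∈ S, ∑ j ∈ S, gridKernel β a n i j)
      ≤ partitionFunction ρ β a n := by
    rw [Finset.mul_sum]
    refine Finset.sum_le_sum fun S hS => ?_
    rw [← Real.exp_add]
    refine Real.exp_le_exp.2 ?_
    linarith [sum_gridKernel_diag_le hβ ha hn (Finset.mem_powerset.1 hS)]
  have h4 := (mul_le_mul_of_nonneg_left h2 (Real.exp_nonneg (-(β / (2 * a))))).trans h3
  rw [← Real.exp_add] at h4
  have h5 := (Real.le_log_iff_exp_le (partitionFunction_pos ρ β a n)).2 h4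
  have h6 := mul_le_mul_of_nonneg_left h5 (show (0 : ℝ) ≤ 1 / n by positivity)
  rw [mul_add] at h6
  have e : (2 * β + β / (2 * a)) / n = 2 * β / n - 1 / n * (-(β / (2 * a))) := by ring
  rw [e]
  linarith

/-- The interaction field at `y` created by the configuration `S`. -/
noncomputable def field (a : ℝ) (n : ℕ) (S : Finset ℕ) (y : ℝ) : ℝ :=
  1 / n * ∑ j ∈ S, K₂ a y (j / n)

lemma sum_gridKernel_eq_field (β a : ℝ) (n : ℕ) (S : Finset ℕ) (i : ℕ) :
    ∑ j ∈ S, gridKernel β a n i j = β * field a n S (i / n) := by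
  simp only [field, gridKernel, Finset.mul_sum]
  exact Finset.sum_congr rfl fun j _ => by ring

lemma field_nonneg (ha : 0 < a) (n : ℕ) (S : Finset ℕ) {y : ℝ} (hy : 0 ≤ y) :
    0 ≤ field a n S y :=
  mul_nonneg (by positivity) (Finset.sum_nonneg fun j _ => K₂_nonneg ha hy (by positivity))

lemma card_le_of_subset_range {n : ℕ} {S : Finset ℕ} (hS : S ⊆ Finset.range n) :
    (S.card : ℝ) ≤ n := by
  have := Finset.card_le_card hS
  rw [Finset.card_range] at this
  exact_mod_cast this

lemma field_le (ha : 0 < a) {n : ℕ} (hn : 0 < n) {S : Finset ℕ} (hS : S ⊆ Finset.range n)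
    (y : ℝ) : field a n S y ≤ 1 / (2 * a) := by
  have hn' : (0 : ℝ) < n := by exact_mod_cast hn
  have h1 : ∑ j ∈ S, K₂ a y (j / n) ≤ S.card • (1 / (2 * a)) :=
    Finset.sum_le_card_nsmul _ _ _ fun j _ => K₂_le ha _ _
  rw [nsmul_eq_mul] at h1
  have h2 := mul_le_mul_of_nonneg_right (card_le_of_subset_range hS)
    (show 0 ≤ 1 / (2 * a) by positivity)
  calc field a n S y ≤ 1 / n * (n * (1 / (2 * a))) :=
        mul_le_mul_of_nonneg_left (h1.trans h2) (by positivity)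
    _ = _ := by field_simp

lemma abs_field_sub_le (ha : 0 < a) {n : ℕ} (hn : 0 < n) {S : Finset ℕ}
    (hS : S ⊆ Finset.range n) {y y' : ℝ} (hy : 0 ≤ y) (hy' : 0 ≤ y') :
    |field a n S y - field a n S y'| ≤ |y - y'| := by
  have hn' : (0 : ℝ) < n := by exact_mod_cast hn
  unfold field
  rw [← mul_sub, ← Finset.sum_sub_distrib, abs_mul, abs_of_pos (by positivity)]
  have h1 : |∑ j ∈ S, (K₂ a y (j / n) - K₂ a y' (j / n))| ≤ S.card • |y - y'| :=
    (Finset.abs_sum_le_sum_abs _ _).trans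
      (Finset.sum_le_card_nsmul _ _ _ fun j _ => abs_K₂_sub_le ha hy hy' (by positivity))
  rw [nsmul_eq_mul] at h1
  have h2 := mul_le_mul_of_nonneg_right (card_le_of_subset_range hS) (abs_nonneg (y - y'))
  calc _ ≤ 1 / n * (n * |y - y'|) :=
        mul_le_mul_of_nonneg_left (h1.trans h2) (by positivity)
    _ = _ := by field_simp

/-- The discretised field of a configuration, rounded down on a grid of size `m`. -/
noncomputable def fieldClass (a : ℝ) (n m : ℕ) (S : Finset ℕ) (l : Fin m) : Fin (m + 1) :=
  ⟨min ⌊m * (2 * a * field a n S ((l : ℕ) / m))⌋₊ m, by omega⟩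

/-- At a grid point, equal rounded values differ by at most `1 / (2a m)`. Moving each of the two
1-Lipschitz fields to the nearby grid point costs a further `1/m`. -/
lemma abs_field_sub_le_of_fieldClass_eq (ha : 0 < a) {n m : ℕ} (hn : 0 < n) (hm : 0 < m)
    {S T : Finset ℕ} (hS : S ⊆ Finset.range n) (hT : T ⊆ Finset.range n)
    (h : fieldClass a n m S = fieldClass a n m T) {i : ℕ} (hi : i < n) :
    |field a n S (i / n) - field a n T (i / n)| ≤ (2 + 1 / (2 * a)) / m := by
  have hn' : (0 : ℝ) < n := by exact_mod_cast hn
  have hm' : (0 : ℝ) < m := by exact_mod_cast hm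
  have hin : (i : ℝ) / n < 1 := (div_lt_one hn').2 (by exact_mod_cast hi)
  have hin0 : (0 : ℝ) ≤ i / n := by positivity
  set l : ℕ := ⌊m * (i / n : ℝ)⌋₊
  have hl : l < m := (Nat.floor_lt (by positivity)).2 (by nlinarith)
  have hl1 : (l : ℝ) ≤ m * (i / n) := Nat.floor_le (by positivity)
  have hl2 : m * (i / n) < (l : ℝ) + 1 := Nat.lt_floor_add_one _
  set y : ℝ := l / m
  have hy0 : 0 ≤ y := by positivity
  have hly : (l : ℝ) = m * y := by simp only [y]; field_simp
  have hy : |(i : ℝ) / n - y| ≤ 1 / m := by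
    rw [le_div_iff₀ hm', ← abs_of_pos hm', ← abs_mul]
    rw [hly] at hl1 hl2
    exact abs_le.2 ⟨by nlinarith, by nlinarith⟩
  -- Since `2 a * field` is at most `1`, the truncation by `min` in `fieldClass` is never active.
  have hle : ∀ U ⊆ Finset.range n, ⌊m * (2 * a * field a n U y)⌋₊ ≤ m := fun U hU => by
    refine Nat.floor_le_of_le (mul_le_of_le_one_right hm'.le ?_)
    have := field_le ha hn hU y
    rw [le_div_iff₀ (by positivity)] at this
    linarith
  have hfl : ⌊m * (2 * a * field a n S y)⌋₊ = ⌊m * (2 * a * field a n T y)⌋₊ := by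
    have := congrArg Fin.val (congrFun h ⟨l, hl⟩)
    simp only [fieldClass] at this
    rwa [min_eq_left (hle S hS), min_eq_left (hle T hT)] at this
  have hST : |field a n S y - field a n T y| ≤ 1 / (2 * a) / m := by
    have s1 := Nat.floor_le (a := m * (2 * a * field a n S y))
      (by have := field_nonneg ha n S hy0; positivity)
    have s2 := Nat.lt_floor_add_one (m * (2 * a * field a n S y))
    have t1 := Nat.floor_le (a := m * (2 * a * field a n T y))
      (by have := field_nonneg ha n T hy0; positivity)
    have t2 := Nat.lt_floor_add_one (m * (2 * a * field a n T y))
    rw [hfl] at s1 s2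
    have hp : 0 < m * (2 * a) := by positivity
    rw [div_div, le_div_iff₀ (by positivity), mul_comm (2 * a), ← abs_of_pos hp, ← abs_mul]
    exact abs_le.2 ⟨by linarith, by linarith⟩
  have h1 := (abs_field_sub_le ha hn hS hin0 hy0).trans hy
  have h2 := (abs_field_sub_le ha hn hT hin0 hy0).trans hy
  rw [abs_le] at h1 h2 hST ⊢
  rw [add_div, show (2 : ℝ) / m = 1 / m + 1 / m by ring]
  constructor <;> linarith [h1.1, h1.2, h2.1, h2.2, hST.1, hST.2]

lemma log_partitionFunction_le (hβ : 0 ≤ β) (ha : 0 < a) {n m : ℕ} (hn : 0 < n) (hm : 0 < m)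
    (hpsd : ∀ v, 0 ≤ bilin (Finset.range n) (gridKernel β a n) v v) {L : ℝ}
    (hL : ∀ f, IsDensity f → densityFunctional ρ β a f ≤ L) :
    1 / n * Real.log (partitionFunction ρ β a n)
      ≤ L + β * (2 + 1 / (2 * a)) / m + (2 * β + m * Real.log (m + 1)) / n := by
  have hn' : (0 : ℝ) < n := by exact_mod_cast hn
  have hM : ∀ p : ℕ → ℝ, (∀ i ∈ Finset.range n, 0 ≤ p i ∧ p i ≤ 1) →
      freeEnergy (Finset.range n) (gridKernel β a n) (Real.log ρ) p ≤ n * L + 2 * β := by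
    intro p hp
    have h1 := (freeEnergy_le_densityFunctional ρ ha hβ hn hp).trans
      (add_le_add_left (hL _ (isDensity_stepFunction hp)) _)
    have h2 := mul_le_mul_of_nonneg_left h1 hn'.le
    calc _ = n * (1 / n * freeEnergy (Finset.range n) (gridKernel β a n) (Real.log ρ) p) := by
          field_simp
      _ ≤ _ := h2
      _ = _ := by field_simp
  have h1 := sum_exp_le_card_mul (Finset.range n) (gridKernel_symm β a n) hpsd (Real.log ρ)
    (ε := β * ((2 + 1 / (2 * a)) / m)) hM (fieldClass a n m) fun S hS T hT hST i hi => by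
      rw [sum_gridKernel_eq_field, sum_gridKernel_eq_field, ← mul_sub, abs_mul, abs_of_nonneg hβ]
      exact mul_le_mul_of_nonneg_left
        (abs_field_sub_le_of_fieldClass_eq ha hn hm hS hT hST (Finset.mem_range.1 hi)) hβ
  have h2 : partitionFunction ρ β a n ≤ ∑ S ∈ (Finset.range n).powerset,
      Real.exp (Real.log ρ * S.card + ∑ i ∈ S, ∑ j ∈ S, gridKernel β a n i j) :=
    Finset.sum_le_sum fun S _ => Real.exp_le_exp.2
      (sub_le_self _ (Finset.sum_nonneg fun i _ => gridKernel_nonneg hβ ha n i i))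
  have h3 := Real.log_le_log (partitionFunction_pos ρ β a n) (h2.trans h1)
  -- There are `(m + 1)^m` classes, whatever `n` is.
  rw [Fintype.card_fun, Fintype.card_fin, Fintype.card_fin,
    Real.log_mul (by positivity) (by positivity), Real.log_exp, Finset.card_range] at h3
  push_cast at h3
  rw [Real.log_pow] at h3
  have h4 := mul_le_mul_of_nonneg_left h3 (show (0 : ℝ) ≤ 1 / n by positivity)
  refine h4.trans (le_of_eq ?_)
  field_simp
  ring

/-- The free energy per site converges to the supremum of the functional. -/
theorem tendsto_log_partitionFunction (hβ : 0 ≤ β) (ha : 0 < a) {x₀ : ℝ} (hx₀ : 0 < x₀)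
    (hpsd : ∀ n, 1 ≤ n → ∀ v, 0 ≤ bilin (Finset.range n) (gridKernel β a n) v v) :
    ∃ L : ℝ, IsLUB (Λ ρ β a '' admissible) L ∧
      Tendsto (fun n : ℕ => 1 / (n : ℝ) * Real.log (x₀ * partitionFunction ρ β a n)) atTop
        (𝓝 L) := by
  have hbdd : BddAbove (Λ ρ β a '' admissible) := by
    -- The lower bound on the partition function holds for every `n`; `n = 1` already shows that the
    -- functional is bounded above.
    refine ⟨1 / (1 : ℕ) * Real.log (partitionFunction ρ β a 1) + (2 * β + β / (2 * a)) / (1 : ℕ), ?_⟩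
    rintro _ ⟨g, hg, rfl⟩
    rw [Λ_eq_densityFunctional ρ β a hg]
    exact densityFunctional_le_log_partitionFunction ρ hβ ha one_pos (hpsd 1 le_rfl)
      (isDensity_deriv hg)
  have hne : (Λ ρ β a '' admissible).Nonempty := ⟨_, _, zero_mem_admissible, rfl⟩
  have hlub := isLUB_csSup hne hbdd
  set L := sSup (Λ ρ β a '' admissible)
  refine ⟨L, hlub, ?_⟩
  have hL : ∀ f, IsDensity f → densityFunctional ρ β a f ≤ L := fun f hf => by
    obtain ⟨g, hg, h⟩ := exists_admissible hf ρ β a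
    exact h ▸ hlub.1 ⟨g, hg, rfl⟩
  have hlow : ∀ n : ℕ, 1 ≤ n →
      L - (2 * β + β / (2 * a)) / n ≤ 1 / n * Real.log (partitionFunction ρ β a n) := by
    intro n hn
    rw [sub_le_iff_le_add]
    refine hlub.2 ?_
    rintro _ ⟨g, hg, rfl⟩
    rw [Λ_eq_densityFunctional ρ β a hg]
    exact densityFunctional_le_log_partitionFunction ρ hβ ha hn (hpsd n hn) (isDensity_deriv hg)
  have hdiv : ∀ c : ℝ, Tendsto (fun n : ℕ => c / (n : ℝ)) atTop (𝓝 0) :=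
    fun c => tendsto_const_div_atTop_nhds_zero_nat c
  have hmain : Tendsto (fun n : ℕ => 1 / (n : ℝ) * Real.log (partitionFunction ρ β a n)) atTop
      (𝓝 L) := by
    rw [tendsto_order]
    constructor
    · intro b hb
      have h1 := (tendsto_order.1 (hdiv (2 * β + β / (2 * a)))).2 (L - b) (by linarith)
      filter_upwards [h1, eventually_ge_atTop 1] with n hn1 hn
      linarith [hlow n hn]
    · intro b hb
      -- The precision `m` is fixed first, so that the entropy of the classes vanishes as `n` grows.
      obtain ⟨m, hm1, hm⟩ := (((tendsto_order.1 (hdiv (β * (2 + 1 / (2 * a))))).2 ((b - L) / 2)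
        (by linarith)).and (eventually_ge_atTop 1)).exists
      have h1 := (tendsto_order.1 (hdiv (2 * β + m * Real.log (m + 1)))).2 ((b - L) / 2)
        (by linarith)
      filter_upwards [h1, eventually_ge_atTop 1] with n hn1 hn
      linarith [log_partitionFunction_le hβ ha hn hm (hpsd n hn) hL]
  have := (hdiv (Real.log x₀)).add hmain
  rw [zero_add] at this
  refine this.congr fun n => ?_
  rw [Real.log_mul hx₀.ne' (partitionFunction_pos ρ β a n).ne']
  ring

end Partition

/-! ### Sums and almost sure limits of centred Gaussian variables. -/

section Gaussian

variable {Ω : Type*} [MeasurableSpace Ω] {P : Measure Ω}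

lemma hasLaw_sum_mul_gaussianReal {X : ℕ → Ω → ℝ} (hX : iIndepFun X P) {h : ℝ≥0}
    (hlaw : ∀ k, HasLaw (X k) (gaussianReal 0 h) P) (b : ℕ → ℝ) (m : ℕ) :
    HasLaw (fun ω => ∑ k ∈ Finset.range m, b k * X k ω)
      (gaussianReal 0 (∑ k ∈ Finset.range m, b k ^ 2 * h).toNNReal) P := by
  have := hX.isProbabilityMeasure
  have hY : iIndepFun (fun k => (fun x => b k * x) ∘ X k) P :=
    hX.comp _ fun k => measurable_const_mul (b k)
  have hm : ∀ k, AEMeasurable ((fun x => b k * x) ∘ X k) P :=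
    fun k => (hlaw k).aemeasurable.const_mul _
  induction m with
  | zero =>
    simp only [Finset.range_zero, Finset.sum_empty, Real.toNNReal_zero, gaussianReal_zero_var]
    exact hasLaw_dirac_of_ae_eq (.of_forall fun _ => rfl)
  | succ m ih =>
    have hlm := gaussianReal_const_mul (hlaw m) (b m)
    have hind := hY.indepFun_finsetSum_of_notMem₀ hm (s := Finset.range m) (i := m) (by simp)
    have e : (∑ k ∈ Finset.range m, (fun x => b k * x) ∘ X k)
        = fun ω => ∑ k ∈ Finset.range m, b k * X k ω := by
      ext ω; simp
    rw [e] at hind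
    have key := gaussianReal_add_gaussianReal_of_indepFun hind ih.map_eq hlm.map_eq
    refine ⟨Finset.aemeasurable_fun_sum _ fun k _ => hm k, ?_⟩
    convert key using 2
    · ext ω
      simp [Finset.sum_range_succ]
    · simp
    · rw [Finset.sum_range_succ, Real.toNNReal_add (Finset.sum_nonneg fun k _ => by positivity)
        (by positivity)]
      congr 1
      ext
      rw [Real.coe_toNNReal _ (by positivity)]
      rfl

/-- Characteristic functions converge by dominated convergence and determine the law. A zero
limiting variance is allowed. -/
lemma hasLaw_gaussianReal_of_tendsto [IsProbabilityMeasure P] {X : ℕ → Ω → ℝ} {Y : Ω → ℝ}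
    {v : ℕ → ℝ≥0} {w : ℝ≥0} (hX : ∀ k, HasLaw (X k) (gaussianReal 0 (v k)) P)
    (hXY : ∀ᵐ ω ∂P, Tendsto (fun k => X k ω) atTop (𝓝 (Y ω))) (hv : Tendsto v atTop (𝓝 w)) :
    HasLaw Y (gaussianReal 0 w) P := by
  have hY : AEMeasurable Y P :=
    aemeasurable_of_tendsto_metrizable_ae atTop (fun k => (hX k).aemeasurable) hXY
  have := Measure.isProbabilityMeasure_map hY
  refine ⟨hY, Measure.ext_of_charFun (funext fun t => ?_)⟩
  have hchar : ∀ U : Ω → ℝ, AEMeasurable U P →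
      charFun (P.map U) t = ∫ ω, Complex.exp (t * U ω * Complex.I) ∂P := fun U hU => by
    rw [charFun_apply_real, integral_map hU (by fun_prop)]
  have h1 : Tendsto (fun k => charFun (P.map (X k)) t) atTop (𝓝 (charFun (P.map Y) t)) := by
    rw [hchar Y hY]
    simp only [fun k => hchar (X k) (hX k).aemeasurable]
    refine tendsto_integral_of_dominated_convergence (fun _ => 1) (fun k => ?_) (by simp)
      (fun k => .of_forall fun ω => ?_) ?_
    · have := (hX k).aemeasurable
      exact AEMeasurable.aestronglyMeasurable (by fun_prop)
    · rw [← Complex.ofReal_mul, Complex.norm_exp_ofReal_mul_I]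
    · filter_upwards [hXY] with ω hω
      exact ((by fun_prop : Continuous fun x : ℝ =>
        Complex.exp (t * x * Complex.I)).tendsto _).comp hω
  have h2 : Tendsto (fun k => charFun (P.map (X k)) t) atTop
      (𝓝 (charFun (gaussianReal 0 w) t)) := by
    simp only [fun k => (hX k).map_eq, charFun_gaussianReal]
    exact ((by fun_prop : Continuous fun u : ℝ≥0 =>
        Complex.exp (t * (0 : ℝ) * Complex.I - ((u : ℝ) : ℂ) * t ^ 2 / 2)).tendsto _).comp hv
  exact tendsto_nhds_unique h1 h2

end Gaussian

/-! ### Pathwise solution of the equation and its approximation by increments. -/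

section Paths

variable {γ σ : ℝ} {w z : ℝ → ℝ}

/-- Explicit solution of the Ornstein-Uhlenbeck equation along a path. -/
lemma exp_mul_eq_of_integral_equation (hw : Continuous w) (hz : Continuous z)
    (h : ∀ t, 0 ≤ t → z t = -(γ * ∫ s in (0 : ℝ)..t, z s) + σ * w t) {t : ℝ} (ht : 0 ≤ t) :
    Real.exp (γ * t) * z t
      = σ * (Real.exp (γ * t) * w t - ∫ s in (0 : ℝ)..t, γ * Real.exp (γ * s) * w s) := by
  set Y : ℝ → ℝ := fun t => ∫ s in (0 : ℝ)..t, z s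
  -- A first integral: only `Y`, the primitive of `z`, gets differentiated, never `w`, and the
  -- integrated equation makes the derivative of `H` vanish.
  set H : ℝ → ℝ := fun t =>
    γ * (Real.exp (γ * t) * Y t) - σ * ∫ s in (0 : ℝ)..t, γ * Real.exp (γ * s) * w s
  have hY : ∀ x, HasDerivAt Y (z x) x := fun x => hz.integral_hasStrictDerivAt 0 x |>.hasDerivAt
  have hI : ∀ x, HasDerivAt (fun t => ∫ s in (0 : ℝ)..t, γ * Real.exp (γ * s) * w s)
      (γ * Real.exp (γ * x) * w x) x := fun x =>
    (Continuous.integral_hasStrictDerivAt (by fun_prop) 0 x).hasDerivAt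
  have hE : ∀ x, HasDerivAt (fun t => Real.exp (γ * t)) (Real.exp (γ * x) * γ) x := fun x => by
    simpa using ((hasDerivAt_id x).const_mul γ).exp
  have hH : ∀ x, HasDerivAt H (γ * (Real.exp (γ * x) * γ * Y x + Real.exp (γ * x) * z x)
      - σ * (γ * Real.exp (γ * x) * w x)) x := fun x =>
    (((hE x).mul (hY x)).const_mul γ).sub ((hI x).const_mul σ)
  have h0 : H t = H 0 := by
    refine constant_of_has_deriv_right_zero (a := 0) (b := t)
      (fun x _ => (hH x).continuousAt.continuousWithinAt) (fun x hx => ?_) t ⟨ht, le_rfl⟩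
    have e : γ * (Real.exp (γ * x) * γ * Y x + Real.exp (γ * x) * z x)
      - σ * (γ * Real.exp (γ * x) * w x) = 0 := by
      rw [h x hx.1]; simp only [Y]; ring
    exact e ▸ (hH x).hasDerivWithinAt
  have h1 : H 0 = 0 := by simp [H, Y]
  rw [h1] at h0
  simp only [H] at h0
  rw [h t ht]
  simp only [Y] at h0
  linear_combination -h0

lemma integral_mul_exp (γ a b : ℝ) :
    ∫ s in a..b, γ * Real.exp (γ * s) = Real.exp (γ * b) - Real.exp (γ * a) := by
  refine intervalIntegral.integral_eq_sub_of_hasDerivAt (f := fun s => Real.exp (γ * s))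
    (fun x _ => ?_) (Continuous.intervalIntegrable (by fun_prop) _ _)
  have := ((hasDerivAt_id x).const_mul γ).exp
  simp only [id, mul_one] at this
  rwa [mul_comm γ (Real.exp _)]

/-- Approximation of the Wiener integral of an exponential by sums over increments. -/
lemma abs_sum_increments_sub_le (hw : Continuous w) (hw0 : w 0 = 0) {h T η : ℝ} (hh : 0 ≤ h)
    {m : ℕ} (hm : m * h = T)
    (hη : ∀ s ∈ Set.Icc 0 T, ∀ s' ∈ Set.Icc 0 T, |s - s'| ≤ h → |w s - w s'| ≤ η) :
    |∑ k ∈ Finset.range m, Real.exp (γ * (k * h)) * (w ((k + 1 : ℕ) * h) - w (k * h))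
      - (Real.exp (γ * T) * w T - ∫ s in (0 : ℝ)..T, γ * Real.exp (γ * s) * w s)|
      ≤ T * (|γ| * Real.exp (|γ| * T) * η) := by
  have hT : 0 ≤ T := hm ▸ by positivity
  have hη0 : 0 ≤ η := (abs_nonneg _).trans (hη 0 ⟨le_rfl, hT⟩ 0 ⟨le_rfl, hT⟩ (by simpa))
  have hint : ∀ a b : ℝ, IntervalIntegrable (fun s => γ * Real.exp (γ * s) * w s) volume a b :=
    fun a b => Continuous.intervalIntegrable (by fun_prop) _ _
  have h1 : ∫ s in (0 : ℝ)..T, γ * Real.exp (γ * s) * w s = ∑ k ∈ Finset.range m,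
      ∫ s in (k * h : ℝ)..((k + 1 : ℕ) * h : ℝ), γ * Real.exp (γ * s) * w s := by
    rw [intervalIntegral.sum_integral_adjacent_intervals (a := fun k : ℕ => (k * h : ℝ))
      fun k _ => hint _ _, hm]
    simp
  have h2 : Real.exp (γ * T) * w T = ∑ k ∈ Finset.range m,
      (Real.exp (γ * ((k + 1 : ℕ) * h)) * w ((k + 1 : ℕ) * h)
        - Real.exp (γ * (k * h)) * w (k * h)) := by
    rw [Finset.sum_range_sub (fun k : ℕ => Real.exp (γ * (k * h)) * w (k * h)), hm]
    simp [hw0]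
  rw [h1, h2, ← Finset.sum_sub_distrib, ← Finset.sum_sub_distrib]
  have key : ∀ k ∈ Finset.range m,
      |Real.exp (γ * (k * h)) * (w ((k + 1 : ℕ) * h) - w (k * h))
      - (Real.exp (γ * ((k + 1 : ℕ) * h)) * w ((k + 1 : ℕ) * h)
        - Real.exp (γ * (k * h)) * w (k * h)
        - ∫ s in (k * h : ℝ)..((k + 1 : ℕ) * h : ℝ), γ * Real.exp (γ * s) * w s)|
      ≤ |γ| * Real.exp (|γ| * T) * η * h := by
    intro k hk
    have hk1 : ((k + 1 : ℕ) : ℝ) * h ≤ T := by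
      rw [← hm]
      exact mul_le_mul_of_nonneg_right (by exact_mod_cast Finset.mem_range.1 hk) hh
    have hk0 : (0 : ℝ) ≤ k * h := by positivity
    have hkk : (k * h : ℝ) ≤ (k + 1 : ℕ) * h := by push_cast; linarith
    have hkd : ((k + 1 : ℕ) * h : ℝ) - k * h = h := by push_cast; ring
    -- Summation by parts on one cell: the error is the integral of `γ e^(γ s)` against the
    -- oscillation of `w` from its right-end value.
    have e : Real.exp (γ * (k * h)) * (w ((k + 1 : ℕ) * h) - w (k * h))
      - (Real.exp (γ * ((k + 1 : ℕ) * h)) * w ((k + 1 : ℕ) * h)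
        - Real.exp (γ * (k * h)) * w (k * h)
        - ∫ s in (k * h : ℝ)..((k + 1 : ℕ) * h : ℝ), γ * Real.exp (γ * s) * w s)
      = ∫ s in (k * h : ℝ)..((k + 1 : ℕ) * h : ℝ),
        γ * Real.exp (γ * s) * w s - γ * Real.exp (γ * s) * w ((k + 1 : ℕ) * h) := by
      rw [intervalIntegral.integral_sub (hint _ _)
        (Continuous.intervalIntegrable (by fun_prop) _ _), intervalIntegral.integral_mul_const,
        integral_mul_exp]
      ring
    rw [e]
    have := intervalIntegral.norm_integral_le_of_norm_le_const (a := (k * h : ℝ))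
      (b := ((k + 1 : ℕ) * h : ℝ)) (C := |γ| * Real.exp (|γ| * T) * η)
      (f := fun s => γ * Real.exp (γ * s) * w s - γ * Real.exp (γ * s) * w ((k + 1 : ℕ) * h)) ?_
    · rwa [hkd, abs_of_nonneg hh, Real.norm_eq_abs] at this
    · intro s hs
      rw [Set.uIoc_of_le hkk] at hs
      have hs0 : 0 ≤ s := hk0.trans hs.1.le
      have hsT : s ≤ T := hs.2.trans hk1
      rw [← mul_sub, Real.norm_eq_abs, abs_mul, abs_mul, Real.abs_exp]
      have hexp : Real.exp (γ * s) ≤ Real.exp (|γ| * T) := Real.exp_le_exp.2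
        (mul_le_mul (le_abs_self γ) hsT hs0 (abs_nonneg γ))
      have hw1 := hη s ⟨hs0, hsT⟩ ((k + 1 : ℕ) * h) ⟨by positivity, hk1⟩
        (abs_le.2 ⟨by linarith [hs.1], by linarith [hs.2]⟩)
      gcongr
  refine (Finset.abs_sum_le_sum_abs _ _).trans ((Finset.sum_le_card_nsmul _ _ _ key).trans ?_)
  rw [Finset.card_range, nsmul_eq_mul, ← hm]
  apply le_of_eq
  ring

/-- Uniform continuity of `w` on the compact interval makes the oscillation bound vanish. Each time
step is cut into `N + 1` pieces, so one mesh serves all `i`. -/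
lemma tendsto_sum_increments (γ : ℝ) (hw : Continuous w) (hw0 : w 0 = 0) {τ : ℝ} (hτ : 0 ≤ τ)
    (i : ℕ) :
    Tendsto (fun N : ℕ => ∑ k ∈ Finset.range (i * (N + 1)),
      Real.exp (γ * (k * (τ / (N + 1)))) * (w ((k + 1 : ℕ) * (τ / (N + 1))) - w (k * (τ / (N + 1)))))
      atTop (𝓝 (Real.exp (γ * (i * τ)) * w (i * τ)
        - ∫ s in (0 : ℝ)..(i * τ), γ * Real.exp (γ * s) * w s)) := by
  set T : ℝ := i * τ
  have hT : 0 ≤ T := by positivity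
  rw [Metric.tendsto_atTop]
  intro ε hε
  set C : ℝ := T * (|γ| * Real.exp (|γ| * T))
  have hC : 0 ≤ C := by positivity
  obtain ⟨δ, hδ, hu⟩ := Metric.uniformContinuousOn_iff.1
    (isCompact_Icc.uniformContinuousOn_of_continuous (s := Set.Icc 0 T) hw.continuousOn)
    (ε / (C + 1)) (by positivity)
  have hlim : Tendsto (fun N : ℕ => τ / ((N : ℝ) + 1)) atTop (𝓝 0) := by
    have := (tendsto_const_div_atTop_nhds_zero_nat τ).comp (tendsto_add_atTop_nat 1)
    refine this.congr fun N => ?_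
    simp
  obtain ⟨N₀, hN₀⟩ := eventually_atTop.1 ((tendsto_order.1 hlim).2 δ hδ)
  refine ⟨N₀, fun N hN => ?_⟩
  have hpos : (0 : ℝ) < (N : ℝ) + 1 := by positivity
  have := abs_sum_increments_sub_le (γ := γ) hw hw0 (h := τ / (N + 1)) (T := T)
    (η := ε / (C + 1)) (m := i * (N + 1)) (by positivity)
    (by push_cast; simp only [T]; field_simp) fun s hs s' hs' hss => by
      have := hu s hs s' hs' (by rw [Real.dist_eq]; exact hss.trans_lt (hN₀ N hN))
      rw [Real.dist_eq] at this
      exact this.le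
  rw [Real.dist_eq]
  refine this.trans_lt ?_
  rw [← mul_assoc T]
  change C * (ε / (C + 1)) < ε
  rw [mul_div_assoc', div_lt_iff₀ (by positivity)]
  nlinarith

end Paths

/-! ### Gaussian law and covariance of the sampled process. -/

section OrnsteinUhlenbeck

/-- The covariance of the Ornstein-Uhlenbeck process started at `0`, at the times `i τ`, `j τ`. -/
noncomputable def ouCov (γ σ τ : ℝ) (i j : ℕ) : ℝ :=
  σ ^ 2 * Real.exp (-(γ * (i * τ)) - γ * (j * τ))
    * ((Real.exp (2 * γ * ((min i j : ℕ) * τ)) - 1) / (2 * γ))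

/-- A Riemann sum, obtained from `tendsto_sum_increments` with the identity as the path; it gives
the limiting variances. -/
lemma tendsto_sum_exp {γ : ℝ} (hγ : γ ≠ 0) {τ : ℝ} (hτ : 0 ≤ τ) (i : ℕ) :
    Tendsto (fun N : ℕ => ∑ k ∈ Finset.range (i * (N + 1)),
      Real.exp (γ * (k * (τ / (N + 1)))) * (τ / (N + 1))) atTop
      (𝓝 ((Real.exp (γ * (i * τ)) - 1) / γ)) := by
  have h := tendsto_sum_increments γ continuous_id rfl hτ i
  have hint : ∫ s in (0 : ℝ)..(i * τ), γ * Real.exp (γ * s) * id s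
      = (Real.exp (γ * (i * τ)) * (i * τ) - Real.exp (γ * (i * τ)) / γ)
        - (Real.exp (γ * 0) * 0 - Real.exp (γ * 0) / γ) := by
    refine intervalIntegral.integral_eq_sub_of_hasDerivAt
      (f := fun s => Real.exp (γ * s) * s - Real.exp (γ * s) / γ)
      (fun x _ => ?_) (Continuous.intervalIntegrable (by fun_prop) _ _)
    have h1 := ((hasDerivAt_id x).const_mul γ).exp
    have h2 := (h1.mul (hasDerivAt_id x)).sub (h1.div_const γ)
    simp only [id, mul_one] at h2
    refine h2.congr_deriv ?_
    simp only [id]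
    field_simp
    ring
  rw [hint] at h
  convert h using 2
  · refine Finset.sum_congr rfl fun k _ => ?_
    simp only [id]
    push_cast
    ring
  · simp only [id, mul_zero, Real.exp_zero]
    ring

lemma min_mul_add_one (i j N : ℕ) :
    min i j * (N + 1) = min (i * (N + 1)) (j * (N + 1)) :=
  (Nat.mul_min_mul_right i j (N + 1)).symm

/-- Two samples share only the increments before the earlier time, whence the `min` in the
covariance. -/
lemma sum_range_ite_mul_ite {m p q : ℕ} (hp : p ≤ m) (f g : ℕ → ℝ) :
    ∑ k ∈ Finset.range m, (if k < p then f k else 0) * (if k < q then g k else 0)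
      = ∑ k ∈ Finset.range (min p q), f k * g k := by
  have h : (Finset.range m).filter (fun k => k < p ∧ k < q) = Finset.range (min p q) := by
    ext k
    simp only [Finset.mem_filter, Finset.mem_range, lt_min_iff]
    omega
  rw [← h, Finset.sum_filter]
  refine Finset.sum_congr rfl fun k _ => ?_
  by_cases h1 : k < p <;> by_cases h2 : k < q <;> simp [h1, h2]

/-- The weight of the `k`-th Brownian increment in the approximation of
`∑ i < n, c i * Z (i * τ)` on the grid of mesh `h`, with `m` mesh points per time step. -/
noncomputable def incrementWeight (γ σ τ : ℝ) (n m : ℕ) (h : ℝ) (c : ℕ → ℝ) (k : ℕ) : ℝ :=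
  ∑ i ∈ Finset.range n, c i * (σ * Real.exp (-(γ * (i * τ))))
    * (if k < i * m then Real.exp (γ * (k * h)) else 0)

lemma sum_incrementWeight_mul (γ σ τ : ℝ) (n m : ℕ) (h : ℝ) (c D : ℕ → ℝ) :
    ∑ k ∈ Finset.range (n * m), incrementWeight γ σ τ n m h c k * D k
      = ∑ i ∈ Finset.range n, c i * (σ * Real.exp (-(γ * (i * τ)))
        * ∑ k ∈ Finset.range (i * m), Real.exp (γ * (k * h)) * D k) := by
  simp only [incrementWeight, Finset.sum_mul]
  rw [Finset.sum_comm]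
  refine Finset.sum_congr rfl fun i hi => ?_
  have hle : i * m ≤ n * m := Nat.mul_le_mul_right m (Finset.mem_range.1 hi).le
  have := sum_range_ite_mul_ite (q := n * m) hle (fun k => Real.exp (γ * (k * h))) D
  rw [min_eq_left hle] at this
  rw [← this, Finset.mul_sum, Finset.mul_sum]
  refine Finset.sum_congr rfl fun k hk => ?_
  rw [if_pos (Finset.mem_range.1 hk)]
  ring

lemma sum_incrementWeight_sq (γ σ τ : ℝ) (n m : ℕ) (h : ℝ) (c : ℕ → ℝ) :
    ∑ k ∈ Finset.range (n * m), incrementWeight γ σ τ n m h c k ^ 2 * h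
      = bilin (Finset.range n) (fun i j => σ ^ 2 * Real.exp (-(γ * (i * τ)) - γ * (j * τ))
        * ∑ k ∈ Finset.range (min (i * m) (j * m)), Real.exp (2 * γ * (k * h)) * h) c c := by
  have hsq : ∀ k, incrementWeight γ σ τ n m h c k ^ 2 * h = ∑ i ∈ Finset.range n,
      ∑ j ∈ Finset.range n, c i * (σ * Real.exp (-(γ * (i * τ))))
        * (if k < i * m then Real.exp (γ * (k * h)) else 0)
        * (c j * (σ * Real.exp (-(γ * (j * τ))))
        * (if k < j * m then Real.exp (γ * (k * h)) else 0)) * h := fun k => by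
    rw [incrementWeight, sq, Finset.sum_mul_sum, Finset.sum_mul]
    simp only [Finset.sum_mul]
  simp only [hsq, bilin]
  rw [Finset.sum_comm]
  refine Finset.sum_congr rfl fun i hi => ?_
  rw [Finset.sum_comm]
  refine Finset.sum_congr rfl fun j hj => ?_
  have hle : i * m ≤ n * m := Nat.mul_le_mul_right m (Finset.mem_range.1 hi).le
  have := sum_range_ite_mul_ite (q := j * m) hle (fun k => Real.exp (γ * (k * h)))
    (fun k => Real.exp (γ * (k * h)))
  have e : ∑ k ∈ Finset.range (min (i * m) (j * m)), Real.exp (2 * γ * (k * h)) * h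
      = h * ∑ k ∈ Finset.range (n * m), (if k < i * m then Real.exp (γ * (k * h)) else 0)
        * (if k < j * m then Real.exp (γ * (k * h)) else 0) := by
    rw [this, Finset.mul_sum]
    refine Finset.sum_congr rfl fun k _ => ?_
    rw [← Real.exp_add, mul_comm]
    ring_nf
  rw [e, sub_eq_add_neg, Real.exp_add, Finset.mul_sum, Finset.mul_sum, Finset.mul_sum]
  refine Finset.sum_congr rfl fun k _ => ?_
  ring

variable {Ω : Type*} [MeasurableSpace Ω] {P : Measure Ω} {γ σ : ℝ} {W Z : ℝ≥0 → Ω → ℝ}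

lemma IsOrnsteinUhlenbeck.tendsto_increments (hZ : IsOrnsteinUhlenbeck P γ σ W Z)
    (hZ₀ : ∀ᵐ ω ∂P, Z 0 ω = 0) (τ : ℝ≥0) :
    ∀ᵐ ω ∂P, ∀ i : ℕ, Tendsto (fun N : ℕ => σ * Real.exp (-(γ * (i * τ)))
      * ∑ k ∈ Finset.range (i * (N + 1)), Real.exp (γ * (k * ((τ / (N + 1) : ℝ≥0) : ℝ)))
        * (W ((k + 1 : ℕ) * (τ / (N + 1))) ω - W (k * (τ / (N + 1))) ω)) atTop
      (𝓝 (Z (i * τ) ω)) := by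
  filter_upwards [hZ.brownian.cont, hZ.brownian.eval_zero_ae_eq_zero, hZ.continuous_paths,
    hZ.equation, hZ₀] with ω hWc hW0 hZc heq hZ0 i
  have hw : Continuous fun s : ℝ => W s.toNNReal ω := hWc.comp continuous_real_toNNReal
  have hz : Continuous fun s : ℝ => Z s.toNNReal ω := hZc.comp continuous_real_toNNReal
  have h1 := exp_mul_eq_of_integral_equation (γ := γ) (σ := σ) hw hz (fun t ht => by
    have := heq t.toNNReal
    rw [hZ0, Real.coe_toNNReal t ht] at this
    rw [this]; ring) (t := i * τ) (by positivity)
  have h2 := (tendsto_sum_increments γ hw (by simpa using hW0) τ.2 i).const_mul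
    (σ * Real.exp (-(γ * (i * τ))))
  have ht : ∀ (k : ℕ) (u : ℝ≥0), ((k : ℝ) * (u : ℝ)).toNNReal = k * u := fun k u => by
    rw [← NNReal.coe_natCast, ← NNReal.coe_mul, Real.toNNReal_coe]
  have e : σ * Real.exp (-(γ * (i * τ))) * (Real.exp (γ * (i * τ)) * W (i * τ : ℝ).toNNReal ω
      - ∫ s in (0 : ℝ)..(i * τ), γ * Real.exp (γ * s) * W s.toNNReal ω) = Z (i * τ) ω := by
    rw [mul_comm σ, mul_assoc, ← h1, ← mul_assoc, ← Real.exp_add, neg_add_cancel, Real.exp_zero,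
      one_mul, ht]
  rw [← e]
  refine h2.congr fun N => ?_
  congr 1
  refine Finset.sum_congr rfl fun k _ => ?_
  have hN : (τ : ℝ) / (N + 1) = ((τ / (N + 1) : ℝ≥0) : ℝ) := by push_cast; rfl
  simp only [NNReal.val_eq_coe, hN, ht]

/-- The finite-dimensional distributions of the Ornstein-Uhlenbeck process started at `0`. -/
theorem IsOrnsteinUhlenbeck.hasLaw_sum (hZ : IsOrnsteinUhlenbeck P γ σ W Z)
    (hZ₀ : ∀ᵐ ω ∂P, Z 0 ω = 0) (hγ : γ ≠ 0) (τ : ℝ≥0) (n : ℕ) (c : ℕ → ℝ) :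
    0 ≤ bilin (Finset.range n) (ouCov γ σ τ) c c ∧
    HasLaw (fun ω => ∑ i ∈ Finset.range n, c i * Z (i * τ) ω)
      (gaussianReal 0 (bilin (Finset.range n) (ouCov γ σ τ) c c).toNNReal) P := by
  have hprob : IsProbabilityMeasure P := hZ.brownian.isGaussianProcess.isProbabilityMeasure
  set h : ℕ → ℝ≥0 := fun N => τ / (N + 1)
  set D : ℕ → ℕ → Ω → ℝ := fun N k ω => W ((k + 1 : ℕ) * h N) ω - W (k * h N) ω
  set v : ℕ → ℝ := fun N => ∑ k ∈ Finset.range (n * (N + 1)),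
    incrementWeight γ σ τ n (N + 1) (h N) c k ^ 2 * h N
  have hlaw : ∀ N, HasLaw (fun ω => ∑ k ∈ Finset.range (n * (N + 1)),
      incrementWeight γ σ τ n (N + 1) (h N) c k * D N k ω) (gaussianReal 0 (v N).toNNReal) P := by
    intro N
    refine hasLaw_sum_mul_gaussianReal (X := D N) ?_ (fun k => ?_) _ _
    · exact hZ.brownian.hasIndepIncrements.nat (t := fun k : ℕ => (k : ℝ≥0) * h N)
        fun a b hab => mul_le_mul_left (by exact_mod_cast hab) _
    · have := hZ.brownian.hasLaw_sub ((k + 1 : ℕ) * h N) (k * h N)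
      have e : h N = nndist ((((k + 1 : ℕ) : ℝ≥0) * h N : ℝ≥0) : ℝ)
          (((k : ℝ≥0) * h N : ℝ≥0) : ℝ) := ?_
      · rw [e]; exact this
      ext
      rw [coe_nndist, Real.dist_eq]
      push_cast
      rw [← sub_mul, add_sub_cancel_left, one_mul, abs_of_nonneg (h N).coe_nonneg]
  have hv : Tendsto v atTop (𝓝 (bilin (Finset.range n) (ouCov γ σ τ) c c)) := by
    simp only [v, sum_incrementWeight_sq, bilin]
    refine tendsto_finsetSum _ fun i _ => tendsto_finsetSum _ fun j _ => ?_
    refine Tendsto.const_mul _ (Tendsto.const_mul _ ?_)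
    refine (tendsto_sum_exp (γ := 2 * γ) (by simpa using hγ) τ.2 (min i j)).congr fun N => ?_
    rw [min_mul_add_one]
    simp [h]
  have hnonneg : ∀ N, 0 ≤ v N := fun N => Finset.sum_nonneg fun k _ => by positivity
  -- The quadratic form is a limit of variances, hence nonnegative: this is the source of the
  -- positive semidefiniteness of the interaction.
  refine ⟨ge_of_tendsto' hv hnonneg, ?_⟩
  refine hasLaw_gaussianReal_of_tendsto hlaw ?_ ((continuous_real_toNNReal.tendsto _).comp hv)
  filter_upwards [hZ.tendsto_increments hZ₀ τ] with ω hω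
  simp only [sum_incrementWeight_mul]
  exact tendsto_finsetSum _ fun i _ => (hω i).const_mul _

end OrnsteinUhlenbeck

/-! ### The expected growth as a partition function. -/

section Growth

variable {Ω : Type*} [MeasurableSpace Ω] {P : Measure Ω}

lemma growth_eq_sum {ρ : ℝ} (hρ : 0 < ρ) (x₀ : ℝ) (Y : ℕ → Ω → ℝ) (n : ℕ) (ω : Ω) :
    growth P ρ x₀ Y n ω = ∑ S ∈ (Finset.range n).powerset,
      x₀ * Real.exp (Real.log ρ * S.card - 1 / 2 * ∑ i ∈ S, Var[Y i; P])
        * Real.exp (∑ i ∈ S, Y i ω) := by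
  have h1 : growth P ρ x₀ Y n ω
      = x₀ * ∏ i ∈ Finset.range n, (1 + ρ * Real.exp (Y i ω - 1 / 2 * Var[Y i; P])) := by
    induction n with
    | zero => simp [growth]
    | succ n ih =>
      rw [Finset.prod_range_succ, growth]
      simp only [ih]
      ring
  rw [h1, Finset.prod_one_add, Finset.mul_sum]
  refine Finset.sum_congr rfl fun S _ => ?_
  rw [mul_assoc, ← Real.exp_add]
  congr 1
  rw [Finset.prod_mul_distrib, Finset.prod_const, ← Real.exp_sum, Finset.sum_sub_distrib,
    ← Finset.mul_sum]
  nth_rewrite 1 [← Real.exp_log hρ]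
  rw [← Real.exp_nat_mul, ← Real.exp_add]
  ring_nf

/-- The expected growth for jointly Gaussian centered inputs with covariance `2 * A`. -/
lemma integrable_growth_and_integral_eq {ρ : ℝ} (hρ : 0 < ρ) (x₀ : ℝ) {Y : ℕ → Ω → ℝ} {n : ℕ}
    {A : ℕ → ℕ → ℝ} (hvar : ∀ i, Var[Y i; P] = 2 * A i i)
    (hpsd : ∀ S ⊆ Finset.range n, 0 ≤ ∑ i ∈ S, ∑ j ∈ S, 2 * A i j)
    (hlaw : ∀ S ⊆ Finset.range n, HasLaw (fun ω => ∑ i ∈ S, Y i ω)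
      (gaussianReal 0 (∑ i ∈ S, ∑ j ∈ S, 2 * A i j).toNNReal) P) :
    Integrable (growth P ρ x₀ Y n) P ∧
    ∫ ω, growth P ρ x₀ Y n ω ∂P = x₀ * ∑ S ∈ (Finset.range n).powerset,
      Real.exp (Real.log ρ * S.card + ∑ i ∈ S, ∑ j ∈ S, A i j - ∑ i ∈ S, A i i) := by
  have hint : ∀ S ∈ (Finset.range n).powerset,
      Integrable (fun ω => Real.exp (∑ i ∈ S, Y i ω)) P := fun S hS => by
    have hl := hlaw S (Finset.mem_powerset.1 hS)
    have h1 := integrable_exp_mul_gaussianReal (μ := 0)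
      (v := (∑ i ∈ S, ∑ j ∈ S, 2 * A i j).toNNReal) 1
    rw [← hl.map_eq] at h1
    simpa [Function.comp_def] using h1.comp_aemeasurable hl.aemeasurable
  have hval : ∀ S ∈ (Finset.range n).powerset,
      ∫ ω, Real.exp (∑ i ∈ S, Y i ω) ∂P = Real.exp (∑ i ∈ S, ∑ j ∈ S, A i j) := fun S hS => by
    -- At parameter `1` the mgf is the exponential of half the variance; the covariance `2 * A`
    -- absorbs this half.
    have h1 := mgf_gaussianReal (hlaw S (Finset.mem_powerset.1 hS)).map_eq 1
    rw [Real.coe_toNNReal _ (hpsd S (Finset.mem_powerset.1 hS))] at h1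
    simp only [mgf, one_mul] at h1
    rw [h1]
    simp only [← Finset.mul_sum]
    ring_nf
  have hfun : growth P ρ x₀ Y n = fun ω => ∑ S ∈ (Finset.range n).powerset,
      x₀ * Real.exp (Real.log ρ * S.card - 1 / 2 * ∑ i ∈ S, Var[Y i; P])
        * Real.exp (∑ i ∈ S, Y i ω) := funext fun ω => growth_eq_sum hρ x₀ Y n ω
  rw [hfun]
  refine ⟨integrable_finsetSum _ fun S hS => (hint S hS).const_mul _, ?_⟩
  rw [integral_finsetSum _ fun S hS => (hint S hS).const_mul _, Finset.mul_sum]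
  refine Finset.sum_congr rfl fun S hS => ?_
  rw [integral_const_mul, hval S hS, mul_assoc, ← Real.exp_add]
  simp only [hvar, ← Finset.mul_sum]
  ring_nf

/-- The scaling gives `γ τ = a / n` and `σ² / (2γ) = 2 (β / n) / (2a)`, while `2 min(i, j) - i - j =
-|i - j|` produces the two exponentials of `K₂`. -/
lemma ouCov_eq {β a γ σ τ : ℝ} {n : ℕ} (hn : 1 ≤ n) (hτ : 0 < τ) (hγ : γ ≠ 0)
    (hσ : β = 1 / 2 * σ ^ 2 * τ * (n : ℝ) ^ 2) (ha : a = γ * τ * n) (i j : ℕ) :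
    ouCov γ σ τ i j = 2 * gridKernel β a n i j := by
  have hn' : (0 : ℝ) < n := by exact_mod_cast hn
  have hexp : Real.exp (-(γ * (i * τ)) - γ * (j * τ))
      * (Real.exp (2 * γ * ((min i j : ℕ) * τ)) - 1)
      = Real.exp (-a * |(i : ℝ) / n - j / n|) - Real.exp (-a * ((i : ℝ) / n + j / n)) := by
    rw [mul_sub, mul_one, ← Real.exp_add]
    congr 2
    · rw [← sub_div, abs_div, abs_of_pos hn', ha, Nat.cast_min]
      rcases le_total (i : ℝ) j with h | h
      · rw [min_eq_left h, abs_of_nonpos (by linarith)]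
        field_simp
        ring
      · rw [min_eq_right h, abs_of_nonneg (by linarith)]
        field_simp
        ring
    · rw [ha]
      field_simp
      ring
  unfold ouCov gridKernel K₂
  rw [← hexp, hσ, ha]
  field_simp

end Growth

end OUGrowth

/-! ### Assembly of the probabilistic and variational parts. -/

theorem mainTheorem2
    (ρ β a x₀ : ℝ) (hρ : 0 < ρ) (hβ : 0 ≤ β) (ha : 0 < a) (hx₀ : 0 < x₀)
    -- for each `n`, a model with parameters `σ n`, `γ n` and time step `τ n`
    (σ γ : ℕ → ℝ) (τ : ℕ → ℝ≥0)
    (hτ : ∀ n, 1 ≤ n → 0 < τ n)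
    (hσ : ∀ n, 1 ≤ n → β = 1 / 2 * σ n ^ 2 * τ n * (n : ℝ) ^ 2)
    (hγ : ∀ n, 1 ≤ n → a = γ n * τ n * n)
    (Ω : ℕ → Type*) [∀ n, MeasurableSpace (Ω n)] (P : ∀ n, Measure (Ω n))
    (W Z : ∀ n, ℝ≥0 → Ω n → ℝ)
    (hZ : ∀ n, 1 ≤ n → OUGrowth.IsOrnsteinUhlenbeck (P n) (γ n) (σ n) (W n) (Z n))
    (hZ₀ : ∀ n, 1 ≤ n → ∀ᵐ ω ∂(P n), Z n 0 ω = 0)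
    (x : ∀ n, ℕ → Ω n → ℝ)
    (hx : ∀ n, x n = OUGrowth.growth (P n) ρ x₀ (fun i => Z n (i * τ n))) :
    (∀ n, 1 ≤ n → Integrable (x n n) (P n)) ∧
    ∃ L : ℝ, IsLUB (OUGrowth.Λ ρ β a '' OUGrowth.admissible) L ∧
      Tendsto (fun n : ℕ => 1 / (n : ℝ) * Real.log (∫ ω, x n n ω ∂(P n))) atTop (𝓝 L) := by
  have hγ0 : ∀ n, 1 ≤ n → γ n ≠ 0 := fun n hn h => by
    have := hγ n hn
    rw [h] at this
    simp only [zero_mul] at this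
    exact ha.ne' this
  have hcov : ∀ n, 1 ≤ n → ∀ i j,
      OUGrowth.ouCov (γ n) (σ n) (τ n) i j = 2 * OUGrowth.gridKernel β a n i j :=
    fun n hn => OUGrowth.ouCov_eq hn (hτ n hn) (hγ0 n hn) (hσ n hn) (hγ n hn)
  have hsum := fun n (hn : 1 ≤ n) => (hZ n hn).hasLaw_sum (hZ₀ n hn) (hγ0 n hn) (τ n)
  have hindic : ∀ n, 1 ≤ n → ∀ m, ∀ S ⊆ Finset.range m,
      0 ≤ ∑ i ∈ S, ∑ j ∈ S, 2 * OUGrowth.gridKernel β a n i j ∧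
      HasLaw (fun ω => ∑ i ∈ S, Z n (i * τ n) ω)
        (gaussianReal 0 (∑ i ∈ S, ∑ j ∈ S, 2 * OUGrowth.gridKernel β a n i j).toNNReal) (P n) := by
    intro n hn m S hS
    -- Coefficients equal to an indicator turn the general linear combination into the sum over `S`.
    have h := hsum n hn m (OUGrowth.indic S)
    simp only [OUGrowth.bilin_indic hS, OUGrowth.sum_indic_mul hS, hcov n hn] at h
    exact h
  have hvar : ∀ n, 1 ≤ n → ∀ i : ℕ,
      Var[Z n (i * τ n); P n] = 2 * OUGrowth.gridKernel β a n i i := by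
    intro n hn i
    -- The variance is needed for every `i`, not only `i < n`, so the index range is enlarged to
    -- contain `i`.
    have h := hindic n hn (i + 1) {i} (by simp)
    simp only [Finset.sum_singleton] at h
    rw [HasLaw.variance_eq h.2, variance_id_gaussianReal, Real.coe_toNNReal _ h.1]
  have hmain := fun n (hn : 1 ≤ n) => OUGrowth.integrable_growth_and_integral_eq (P := P n)
    hρ x₀ (Y := fun i => Z n (i * τ n)) (n := n) (A := OUGrowth.gridKernel β a n) (hvar n hn)
    (fun S hS => (hindic n hn n S hS).1) (fun S hS => (hindic n hn n S hS).2)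
  refine ⟨fun n hn => by rw [hx n]; exact (hmain n hn).1, ?_⟩
  have hpsd : ∀ n, 1 ≤ n → ∀ v,
      0 ≤ OUGrowth.bilin (Finset.range n) (OUGrowth.gridKernel β a n) v v := by
    intro n hn v
    have h := (hsum n hn n v).1
    have e : OUGrowth.bilin (Finset.range n) (OUGrowth.ouCov (γ n) (σ n) (τ n)) v v
        = 2 * OUGrowth.bilin (Finset.range n) (OUGrowth.gridKernel β a n) v v := by
      simp only [OUGrowth.bilin, hcov n hn, Finset.mul_sum]
      exact Finset.sum_congr rfl fun i _ => Finset.sum_congr rfl fun j _ => by ring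
    linarith
  obtain ⟨L, hL, hlim⟩ := OUGrowth.tendsto_log_partitionFunction (ρ := ρ) hβ ha hx₀ hpsd
  refine ⟨L, hL, hlim.congr' ?_⟩
  filter_upwards [eventually_ge_atTop 1] with n hn
  rw [hx n, (hmain n hn).2]
  rfl
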